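/- Let $d\ge 1$ and $l\ge 0$ be integers, and fix an encoding of numbers by $l$-bit strings, i.e. a map $\mathrm{val}\colon\{0,1\}^l\to\mathbb{R}$ (for example fixed-point or floating-point numbers). Let $F\colon[d]\to[0,1]$ be a function whose values are represented in this encoding, $F(i)=\mathrm{val}(x_i)$ with $x_i\in\{0,1\}^l$. A quantum oracle for $F$ is the unitary $$O_F\,|i\rangle|z\rangle=|i\rangle|z\oplus x_i\rangle\qquad(i\in[d],\ z\in\{0,1\}^l),$$ where $\oplus$ is bitwise XOR; in particular $O_F|i\rangle|0\rangle=|i\rangle|x_i\rangle$. Write $m=\frac1d\sum_{i=1}^d F(i)$. A quantum algorithm with $T$ queries starts from a fixed computational basis state of an index register, an $l$-qubit answer register and a finite-dimensional workspace, applies $U_T O_F U_{T-1} O_F\cdots O_F U_0$ with unitaries $U_0,\dots,U_T$ that do not depend on $F$ (here $O_F$ acts as the identity on the workspace), measures all registers in the computational basis, and returns a real number that is a fixed function of the outcome. There is a universal constant $C>0$ such that for all $d\ge1$, $l\ge 0$, every encoding $\mathrm{val}$ and every $\delta>0$ there is a quantum algorithm that makes at most $C\sqrt d/\delta$ queries and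 that, for every $F\colon[d]\to[0,1]$ represented in the encoding, given the oracle $O_F$, returns $\tilde m$ with $$|\tilde m-m|\le\delta m$$ with probability at least $2/3$. -/

import Mathlib

noncomputable section

namespace QuantumQuery

/-- Strings of `l` bits. -/
abbrev BitString (l : ℕ) : Type := Fin l → Bool

/-- Computational basis labels `(i, z, w)`: an index register `i`, an `l`-qubit answer register `z`
and a workspace register `w`. -/
abbrev Label (d l : ℕ) (W : Type) : Type := Fin d × BitString l × W

/-- The action of the oracle on basis labels, `(i, z, w) ↦ (i, z ⊕ x i, w)`, with bitwise XOR. -/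
def queryLabel {d l : ℕ} {W : Type} (x : Fin d → BitString l) (b : Label d l W) : Label d l W :=
  (b.1, fun k => xor (b.2.1 k) (x b.1 k), b.2.2)

/-- The quantum oracle for the table `x`, as a matrix on `ℂ^d ⊗ (ℂ^2)^{⊗ l} ⊗ ℂ^W`:
`|i⟩|z⟩|w⟩ ↦ |i⟩|z ⊕ x i⟩|w⟩`; in particular `|i⟩|0⟩|w⟩ ↦ |i⟩|x i⟩|w⟩`. -/
def oracle {d l : ℕ} (W : Type) [DecidableEq W] (x : Fin d → BitString l) :
    Matrix (Label d l W) (Label d l W) ℂ :=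
  Matrix.of fun b' b => if b' = queryLabel x b then 1 else 0

/-- A quantum query algorithm with access to an oracle for a table `Fin d → BitString l`: a finite
workspace, a basis state to start from, a number `queries` of oracle calls, the unitaries
`gate 0, …, gate queries` applied before, between and after the calls (later values of `gate` are
never used), and the real number that is returned for each outcome of the final measurement of all
registers in the computational basis. None of this depends on the table. -/
structure QueryAlgorithm (d l : ℕ) where
  W : Type
  [fintypeW : Fintype W]
  [decEqW : DecidableEq W]
  start : Label d l W
  queries : ℕ
  gate : ℕ → Matrix.unitaryGroup (Label d l W) ℂ
  output : Label d l W → ℝ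

attribute [instance] QueryAlgorithm.fintypeW QueryAlgorithm.decEqW

namespace QueryAlgorithm

variable {d l : ℕ}

/-- The state `U_t O U_{t-1} O ⋯ O U_0 |start⟩` reached after `t` oracle calls. -/
def state (A : QueryAlgorithm d l) (x : Fin d → BitString l) : ℕ → Label d l A.W → ℂ
  | 0 => (A.gate 0).1.mulVec (Pi.single A.start 1)
  | t + 1 => (A.gate (t + 1)).1.mulVec ((oracle A.W x).mulVec (A.state x t))

/-- The probability (Born rule) that the number returned by `A` on the table `x` lies in `S`. -/
def prob (A : QueryAlgorithm d l) (x : Fin d → BitString l) (S : Set ℝ) : ℝ :=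
  ∑ b, (A.output ⁻¹' S).indicator (fun b => ‖A.state x A.queries b‖ ^ 2) b

end QueryAlgorithm

/-- The mean `(1/d) ∑ i, F i`. -/
def mean {d : ℕ} (F : Fin d → ℝ) : ℝ := 1 / (d : ℝ) * ∑ i, F i

end QuantumQuery

end

/-!
The algorithm first finds the maximum `v` of the table and then estimates the mean relative to `v`.
The mean of `F / v` is at least `1 / d`, however small the values of `F` are, and this is what bounds
the number of queries by `√d / δ`.

Both stages run the same quantum walk. Let `ψ` be the uniform superposition over the indices, with an
ancilla qubit in the state `0`. A query, a reflection of the ancilla by an angle `t (x i)` that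
depends on the queried string, and a second query make up a reflection `W`, and `⟨ψ, W ψ⟩` is the mean
`c` of the numbers `cos (t (x i))`. The product of `W` and the reflection about `ψ` rotates a plane:
its iterates on `ψ` satisfy the recurrence `ψ (m + 2) + ψ m = 2 c ψ (m + 1)` (`walk_add_two`). The
number of steps is put into superposition by a counter, with weights that depend on the purpose
(`state_walkRoutine`); a round that the counter switches off costs two queries that cancel.

For maximum finding, the angle marks the values above the current threshold. If `r` values lie above
it and the number of steps is uniform on at least `√(d / r)` numbers, then each of them is found with
probability at least `1 / (8 r)` (`le_prob_raise`), so `r` is divided by four with constant probability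
(`le_prob_raise_top`). In the phase in which `r` falls below `4 ^ s`, a number of repetitions that is
linear in `s` makes the failure probability `2⁻⁽ˢ⁺⁴⁾`, and since one repetition costs `O(√d / 2 ^ s)`
queries, all phases together cost `O(√d)` (`exists_maximum`).

For the estimate, the cosine of the angle is `1 - val (x i) / v`, and `c = 1 - mean / v`. If every
weight of the counter were equal, the recurrence would make the superposition an eigenvector, with
eigenvalue `c`, of half the adjacency matrix of a path, up to boundary terms. With the weights
`k * (M - k)`, which vanish at the boundary, it is nearly one (`sum_norm_sq_window_sub_le`), so that
the eigenvalue measured in the eigenbasis of the path has mean squared deviation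
`O((1 - c ^ 2) / M ^ 2 + 1 / M ^ 4)` from `c` (`sum_sq_estimate_le`). Chebyshev's inequality concludes
(`le_prob_estimate`).

The adaptive steps are joined by deferred measurement: the outcome of one algorithm controls the gates
of the next one, and probabilities multiply as for classical composition
(`QueryAlgorithm.prob_bind`).
-/

noncomputable section

namespace QuantumQuery

open Matrix

-- Instances on nested products of registers exceed the default size.
set_option synthInstance.maxSize 1000

variable {d l : ℕ}

/-! ### Unitary gates -/

/-- Unitary matrices preserve the sum of the squared moduli. -/
theorem sum_norm_sq_mulVec {n : Type*} [Fintype n] [DecidableEq n] (U : unitaryGroup n ℂ)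
    (φ : n → ℂ) : ∑ b, ‖(U.1 *ᵥ φ) b‖ ^ 2 = ∑ b, ‖φ b‖ ^ 2 := by
  have key : ∀ v : n → ℂ, ((∑ b, ‖v b‖ ^ 2 : ℝ) : ℂ) = star v ⬝ᵥ v := by
    intro v
    push_cast
    refine Finset.sum_congr rfl fun b _ => ?_
    rw [Pi.star_apply, ← Complex.conj_mul']
    rfl
  have h : ((∑ b, ‖(U.1 *ᵥ φ) b‖ ^ 2 : ℝ) : ℂ) = ((∑ b, ‖φ b‖ ^ 2 : ℝ) : ℂ) := by
    rw [key, key, star_mulVec, ← dotProduct_mulVec, mulVec_mulVec, ← star_eq_conjTranspose,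
      UnitaryGroup.star_mul_self, one_mulVec]
  exact_mod_cast h

/-- The gate that applies `U c` to the factor `B` of a register split as `L ≃ B × C` when the factor
`C` is in the basis state `c`. -/
def ctrl {L B C : Type*} [Fintype L] [DecidableEq L] [Fintype B] [DecidableEq B] [Fintype C]
    [DecidableEq C] (e : L ≃ B × C) (U : C → unitaryGroup B ℂ) : unitaryGroup L ℂ :=
  ⟨(blockDiagonal fun c => (U c).1).submatrix e e, by
    rw [mem_unitaryGroup_iff, star_eq_conjTranspose, conjTranspose_submatrix,
      submatrix_mul_equiv, blockDiagonal_conjTranspose, ← blockDiagonal_mul]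
    have : (fun c => (U c).1 * (U c).1ᴴ) = 1 :=
      funext fun c => (mem_unitaryGroup_iff.1 (U c).2 :)
    rw [this, blockDiagonal_one, submatrix_one_equiv]⟩

theorem ctrl_mulVec {L B C : Type*} [Fintype L] [DecidableEq L] [Fintype B] [DecidableEq B]
    [Fintype C] [DecidableEq C] (e : L ≃ B × C) (U : C → unitaryGroup B ℂ) (Φ : L → ℂ)
    (b : B) (c : C) :
    ((ctrl e U).1 *ᵥ Φ) (e.symm (b, c)) = ((U c).1 *ᵥ fun b' => Φ (e.symm (b', c))) b := by
  simp only [ctrl, mulVec, dotProduct, submatrix_apply]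
  rw [← e.symm.sum_comp, Fintype.sum_prod_type]
  refine Finset.sum_congr rfl fun b' _ => ?_
  rw [Finset.sum_eq_single c]
  · simp
  · intro c' _ h
    simp [blockDiagonal_apply, h.symm]
  · simp

/-- The gate that permutes the basis states by `σ`. -/
def permGate {L : Type*} [Fintype L] [DecidableEq L] (σ : L ≃ L) : unitaryGroup L ℂ :=
  ⟨(1 : Matrix L L ℂ).submatrix σ.symm id, by
    rw [mem_unitaryGroup_iff, star_eq_conjTranspose, conjTranspose_submatrix,
      ← submatrix_mul _ _ _ id _ Function.bijective_id, conjTranspose_one, mul_one,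
      submatrix_one_equiv]⟩

theorem permGate_mulVec {L : Type*} [Fintype L] [DecidableEq L] (σ : L ≃ L) (Φ : L → ℂ) (b : L) :
    ((permGate σ).1 *ᵥ Φ) b = Φ (σ.symm b) := by
  simp [permGate, mulVec, dotProduct, one_apply]

/-- Every unit vector can be prepared from a given basis state by a gate. -/
theorem exists_gate_single {L : Type*} [Fintype L] [DecidableEq L] (b₀ : L) (Φ : L → ℂ)
    (h : ∑ b, ‖Φ b‖ ^ 2 = 1) : ∃ U : unitaryGroup L ℂ, U.1 *ᵥ Pi.single b₀ 1 = Φ := by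
  let v : L → EuclideanSpace ℂ L := fun _ => WithLp.toLp 2 Φ
  have hv : ‖v b₀‖ = 1 := by
    rw [EuclideanSpace.norm_eq]
    simp [v, h]
  have ho : Orthonormal ℂ (({b₀} : Set L).domRestrict v) := by
    refine ⟨fun i => by simpa [v] using hv, fun i j hij => ?_⟩
    exact absurd (Subsingleton.elim i j) hij
  obtain ⟨b, hb⟩ := Orthonormal.exists_orthonormalBasis_extension_of_card_eq
    (ι := L) (by simp) ho
  refine ⟨⟨(EuclideanSpace.basisFun L ℂ).toBasis.toMatrix b, ?_⟩, ?_⟩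
  · exact (EuclideanSpace.basisFun L ℂ).toMatrix_orthonormalBasis_mem_unitary b
  · funext i
    rw [mulVec_single_one]
    change (EuclideanSpace.basisFun L ℂ).toBasis.toMatrix b i b₀ = _
    rw [Module.Basis.toMatrix_apply, hb b₀ rfl]
    simp [v]

/-! ### The oracle -/

theorem queryLabel_involutive {W : Type} (x : Fin d → BitString l) :
    Function.Involutive (queryLabel (W := W) x) := by
  rintro ⟨i, z, w⟩
  simp [queryLabel]

theorem oracle_mulVec {W : Type} [Fintype W] [DecidableEq W] (x : Fin d → BitString l)
    (φ : Label d l W → ℂ) (b : Label d l W) : (oracle W x *ᵥ φ) b = φ (queryLabel x b) := by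
  have h : ∀ b', b = queryLabel x b' ↔ b' = queryLabel x b := fun b' =>
    ⟨fun h => by rw [h, queryLabel_involutive], fun h => by rw [h, queryLabel_involutive]⟩
  simp [oracle, mulVec, dotProduct, h]

theorem sum_norm_sq_oracle {W : Type} [Fintype W] [DecidableEq W]
    (x : Fin d → BitString l) (φ : Label d l W → ℂ) :
    ∑ b, ‖(oracle W x *ᵥ φ) b‖ ^ 2 = ∑ b, ‖φ b‖ ^ 2 := by
  simp only [oracle_mulVec]
  exact (queryLabel_involutive x).bijective.sum_comp fun b => ‖φ b‖ ^ 2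

/-! ### Outcome probabilities -/

namespace QueryAlgorithm

variable (A : QueryAlgorithm d l) (x : Fin d → BitString l)

theorem sum_norm_sq_state (t : ℕ) : ∑ b, ‖A.state x t b‖ ^ 2 = 1 := by
  induction t with
  | zero =>
    rw [state, sum_norm_sq_mulVec, Finset.sum_eq_single A.start]
    · simp
    · intro b _ hb
      simp [hb]
    · simp
  | succ t ih => rw [state, sum_norm_sq_mulVec, sum_norm_sq_oracle, ih]

theorem prob_mono {S T : Set ℝ} (h : S ⊆ T) : A.prob x S ≤ A.prob x T :=
  Finset.sum_le_sum fun _ _ => Set.indicator_le_indicator_of_subset (Set.preimage_mono h)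
    (fun _ => by positivity) _

theorem prob_nonneg (S : Set ℝ) : 0 ≤ A.prob x S :=
  Finset.sum_nonneg fun _ _ => Set.indicator_nonneg (fun _ _ => by positivity) _

/-- A set that contains the outputs of all basis states in the support of the final state has
probability one. -/
theorem prob_eq_one {S : Set ℝ} (h : ∀ b, A.state x A.queries b ≠ 0 → A.output b ∈ S) :
    A.prob x S = 1 := by
  rw [← A.sum_norm_sq_state x A.queries]
  refine Finset.sum_congr rfl fun b _ => ?_
  by_cases hb : A.output b ∈ S
  · exact Set.indicator_of_mem (s := A.output ⁻¹' S) hb _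
  · have := not_imp_comm.1 (h b) hb
    simp [Set.indicator, this]

theorem prob_union_disjoint {S T : Set ℝ} (h : Disjoint S T) :
    A.prob x (S ∪ T) = A.prob x S + A.prob x T := by
  rw [prob, prob, prob, ← Finset.sum_add_distrib]
  refine Finset.sum_congr rfl fun b _ => ?_
  rw [Set.preimage_union, Set.indicator_union_of_disjoint (h.preimage _)]

theorem prob_compl (S : Set ℝ) : A.prob x Sᶜ = 1 - A.prob x S := by
  have h := A.prob_union_disjoint x (disjoint_compl_right (a := S))
  rw [Set.union_compl_self, A.prob_eq_one x fun _ _ => Set.mem_univ _] at h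
  linarith

end QueryAlgorithm

/-! ### Sequential composition -/

/-- A family of query algorithms indexed by a real parameter, which share their workspace, their
start state and their number of queries, so that they can be run under the control of a register
that determines the parameter. -/
structure Routine (d l : ℕ) where
  W : Type
  [fintypeW : Fintype W]
  [decEqW : DecidableEq W]
  start : Label d l W
  queries : ℕ
  gate : ℝ → ℕ → Matrix.unitaryGroup (Label d l W) ℂ
  output : ℝ → Label d l W → ℝ

attribute [instance] Routine.fintypeW Routine.decEqW

/-- The member of a routine with parameter `v`. -/
def Routine.at (R : Routine d l) (v : ℝ) : QueryAlgorithm d l where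
  W := R.W
  start := R.start
  queries := R.queries
  gate := R.gate v
  output := R.output v

/-- A product register seen from its first half: the index and answer registers belong to the label
of the first algorithm. -/
def splitFirst (W₁ W₂ : Type) :
    Label d l (W₁ × (Fin d × BitString l) × W₂) ≃ Label d l W₁ × ((Fin d × BitString l) × W₂) where
  toFun b := ((b.1, b.2.1, b.2.2.1), b.2.2.2)
  invFun c := (c.1.1, c.1.2.1, c.1.2.2, c.2)
  left_inv _ := rfl
  right_inv _ := rfl

/-- A product register seen from its second half: the index and answer registers belong to the label
of the second algorithm, and the stored pair completes the label of the first one. -/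
def splitSecond (W₁ W₂ : Type) :
    Label d l (W₁ × (Fin d × BitString l) × W₂) ≃ Label d l W₂ × Label d l W₁ where
  toFun b := ((b.1, b.2.1, b.2.2.2.2), (b.2.2.2.1.1, b.2.2.2.1.2, b.2.2.1))
  invFun c := (c.1.1, c.1.2.1, c.2.2.2, (c.2.1, c.2.2.1), c.1.2.2)
  left_inv _ := rfl
  right_inv _ := rfl

/-- The exchange of the index and answer registers with the stored pair. -/
def exchange (W₁ W₂ : Type) :
    Label d l (W₁ × (Fin d × BitString l) × W₂) ≃ Label d l (W₁ × (Fin d × BitString l) × W₂) where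
  toFun b := (b.2.2.2.1.1, b.2.2.2.1.2, b.2.2.1, (b.1, b.2.1), b.2.2.2.2)
  invFun b := (b.2.2.2.1.1, b.2.2.2.1.2, b.2.2.1, (b.1, b.2.1), b.2.2.2.2)
  left_inv _ := rfl
  right_inv _ := rfl

/-- The states reached by a sequence `g` of gates, interleaved with oracle calls, from `φ`. -/
def evolve {W : Type} [Fintype W] [DecidableEq W] (g : ℕ → unitaryGroup (Label d l W) ℂ)
    (φ : Label d l W → ℂ) (x : Fin d → BitString l) : ℕ → Label d l W → ℂ
  | 0 => (g 0).1 *ᵥ φ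
  | t + 1 => (g (t + 1)).1 *ᵥ (oracle W x *ᵥ evolve g φ x t)

/-- The state just before gate number `t`. -/
def evolveBefore {W : Type} [Fintype W] [DecidableEq W] (g : ℕ → unitaryGroup (Label d l W) ℂ)
    (φ : Label d l W → ℂ) (x : Fin d → BitString l) : ℕ → Label d l W → ℂ
  | 0 => φ
  | t + 1 => oracle W x *ᵥ evolve g φ x t

theorem evolve_eq {W : Type} [Fintype W] [DecidableEq W] (g : ℕ → unitaryGroup (Label d l W) ℂ)
    (φ : Label d l W → ℂ) (x : Fin d → BitString l) (t : ℕ) :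
    evolve g φ x t = (g t).1 *ᵥ evolveBefore g φ x t := by
  cases t <;> rfl

theorem QueryAlgorithm.state_eq_evolve (A : QueryAlgorithm d l) (x : Fin d → BitString l) (t : ℕ) :
    A.state x t = evolve A.gate (Pi.single A.start 1) x t := by
  induction t with
  | zero => rfl
  | succ t ih => rw [QueryAlgorithm.state, ih, evolve]

section Composition

variable {W₁ W₂ : Type} [Fintype W₁] [DecidableEq W₁] [Fintype W₂] [DecidableEq W₂]
  (T : ℕ) (g : ℕ → unitaryGroup (Label d l W₁) ℂ)
  (h : Label d l W₁ → ℕ → unitaryGroup (Label d l W₂) ℂ)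
  (s : Label d l W₁) (r : Label d l W₂) (x : Fin d → BitString l)

/-- The gates that apply `g` up to time `T` and then, controlled by the label that `g` has reached,
`h`. -/
def bindGate (t : ℕ) : unitaryGroup (Label d l (W₁ × (Fin d × BitString l) × W₂)) ℂ :=
  if t < T then ctrl (splitFirst W₁ W₂) fun _ => g t
  else if t = T then
    ctrl (splitSecond W₁ W₂) (fun b => h b 0) * permGate (exchange W₁ W₂) *
      ctrl (splitFirst W₁ W₂) fun _ => g t
  else ctrl (splitSecond W₁ W₂) fun b => h b (t - T)

/-- The start label of a composition. -/
def bindStart : Label d l (W₁ × (Fin d × BitString l) × W₂) :=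
  (splitFirst W₁ W₂).symm (s, (r.1, r.2.1), r.2.2)

/-- Up to time `T`, the registers that wait for the second algorithm are untouched. -/
theorem evolveBefore_bindGate (t : ℕ) (ht : t ≤ T) (b : Label d l W₁)
    (c : (Fin d × BitString l) × W₂) :
    evolveBefore (bindGate T g h) (Pi.single (bindStart s r) 1) x t
        ((splitFirst W₁ W₂).symm (b, c)) =
      evolveBefore g (Pi.single s 1) x t b *
        Pi.single (M := fun _ => ℂ) ((r.1, r.2.1), r.2.2) 1 c := by
  induction t generalizing b c with
  | zero =>
    simp only [evolveBefore, bindStart, Pi.single_apply, EmbeddingLike.apply_eq_iff_eq]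
    have hp : (b, c) = (s, ((r.1, r.2.1), r.2.2)) ↔ b = s ∧ c = ((r.1, r.2.1), r.2.2) :=
      Prod.mk_inj
    simp only [hp, ite_and, ite_mul, one_mul, zero_mul]
  | succ t ih =>
    have hg : bindGate T g h t = ctrl (splitFirst W₁ W₂) fun _ => g t := if_pos ht
    simp only [evolveBefore]
    rw [oracle_mulVec, oracle_mulVec]
    change evolve _ _ x t ((splitFirst W₁ W₂).symm (queryLabel x b, c)) = _
    rw [evolve_eq, evolve_eq, hg, ctrl_mulVec]
    simp only [fun b' => ih (by omega) b' c, mulVec, dotProduct, Finset.sum_mul, mul_assoc]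

/-- After time `T`, the amplitudes are products of the amplitudes at time `T` and of those of the
second algorithm. -/
theorem evolve_bindGate (t : ℕ) (b : Label d l W₁) (b' : Label d l W₂) :
    evolve (bindGate T g h) (Pi.single (bindStart s r) 1) x (T + t)
        ((splitSecond W₁ W₂).symm (b', b)) =
      evolve g (Pi.single s 1) x T b * evolve (h b) (Pi.single r 1) x t b' := by
  induction t generalizing b b' with
  | zero =>
    have hg : bindGate T g h T = ctrl (splitSecond W₁ W₂) (fun b => h b 0) *
        permGate (exchange W₁ W₂) * ctrl (splitFirst W₁ W₂) fun _ => g T :=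
      (if_neg (lt_irrefl _)).trans (if_pos rfl)
    rw [Nat.add_zero, evolve_eq, hg, UnitaryGroup.mul_val, UnitaryGroup.mul_val,
      ← mulVec_mulVec, ← mulVec_mulVec, ctrl_mulVec]
    have h' : (fun c' : Label d l W₂ => ((permGate (exchange W₁ W₂)).1 *ᵥ
        (ctrl (splitFirst W₁ W₂) fun _ => g T).1 *ᵥ
          evolveBefore (bindGate T g h) (Pi.single (bindStart s r) 1) x T)
          ((splitSecond W₁ W₂).symm (c', b))) =
        evolve g (Pi.single s 1) x T b • Pi.single (M := fun _ => ℂ) r 1 := by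
      funext c'
      rw [permGate_mulVec]
      change ((ctrl (splitFirst W₁ W₂) fun _ => g T).1 *ᵥ _)
        ((splitFirst W₁ W₂).symm (b, ((c'.1, c'.2.1), c'.2.2))) = _
      rw [ctrl_mulVec]
      simp only [evolveBefore_bindGate T g h s r x T le_rfl]
      have hs : Pi.single (M := fun _ => ℂ) ((r.1, r.2.1), r.2.2) 1
          ((c'.1, c'.2.1), c'.2.2) = Pi.single (M := fun _ => ℂ) r (1 : ℂ) c' := by
        simp only [Pi.single_apply, Prod.ext_iff, and_assoc]
      simp only [evolve_eq g, Pi.smul_apply, smul_eq_mul, hs, mulVec, dotProduct, Finset.sum_mul,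
        mul_assoc]
    rw [h', mulVec_smul]
    rfl
  | succ t ih =>
    have hg : bindGate T g h (T + t + 1) = ctrl (splitSecond W₁ W₂) fun b => h b (t + 1) := by
      have h1 : ¬ T + t + 1 < T := by omega
      have h2 : ¬ T + t + 1 = T := by omega
      have h3 : T + t + 1 - T = t + 1 := by omega
      simp only [bindGate, if_neg h1, if_neg h2, h3]
    rw [← add_assoc, evolve, hg, ctrl_mulVec]
    have h' : (fun c' : Label d l W₂ => (oracle (W₁ × (Fin d × BitString l) × W₂) x *ᵥ
        evolve (bindGate T g h) (Pi.single (bindStart s r) 1) x (T + t))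
          ((splitSecond W₁ W₂).symm (c', b))) =
        evolve g (Pi.single s 1) x T b • (oracle W₂ x *ᵥ evolve (h b) (Pi.single r 1) x t) := by
      funext c'
      rw [oracle_mulVec, Pi.smul_apply, oracle_mulVec]
      exact ih b (queryLabel x c')
    rw [h', mulVec_smul]
    rfl

end Composition

/-- Run `A`, and then the member of `R` whose parameter is the output of `A`. The measurement of `A`
is deferred: its final label is moved to the workspace, where it only controls the gates of `R`. -/
def QueryAlgorithm.bind (A : QueryAlgorithm d l) (R : Routine d l) : QueryAlgorithm d l where
  W := A.W × (Fin d × BitString l) × R.W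
  start := bindStart A.start R.start
  queries := A.queries + R.queries
  gate := bindGate A.queries A.gate fun b => R.gate (A.output b)
  output b := R.output (A.output (splitSecond A.W R.W b).2) (splitSecond A.W R.W b).1

namespace QueryAlgorithm

variable (A : QueryAlgorithm d l) (R : Routine d l) (x : Fin d → BitString l)

theorem state_bind (b : Label d l A.W) (b' : Label d l R.W) :
    (A.bind R).state x (A.bind R).queries ((splitSecond A.W R.W).symm (b', b)) =
      A.state x A.queries b * (R.at (A.output b)).state x R.queries b' := by
  rw [state_eq_evolve, state_eq_evolve, state_eq_evolve]
  exact evolve_bindGate A.queries A.gate (fun b => R.gate (A.output b)) A.start R.start x _ b b'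

/-- The outcome of a composition is distributed as for classical sequential composition. -/
theorem prob_bind (S : Set ℝ) :
    (A.bind R).prob x S =
      ∑ b, ‖A.state x A.queries b‖ ^ 2 * (R.at (A.output b)).prob x S := by
  refine ((splitSecond A.W R.W).symm.sum_comp _).symm.trans ?_
  rw [Fintype.sum_prod_type, Finset.sum_comm]
  refine Finset.sum_congr rfl fun b _ => ?_
  rw [prob, Finset.mul_sum]
  refine Finset.sum_congr rfl fun b' _ => ?_
  simp only [Set.indicator, mul_ite, mul_zero]
  rw [state_bind, norm_mul, mul_pow]
  rfl

/-- If `A` outputs an element of `S` with probability at least `p`, and `R` leads from each element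
of `S` to `T` with probability at least `q`, then the composition ends in `T` with probability at
least `p * q`. -/
theorem mul_le_prob_bind {S T : Set ℝ} {p q : ℝ} (hq : 0 ≤ q) (hA : p ≤ A.prob x S)
    (hR : ∀ v ∈ S, q ≤ (R.at v).prob x T) : p * q ≤ (A.bind R).prob x T := by
  rw [prob_bind]
  refine (mul_le_mul_of_nonneg_right hA hq).trans ?_
  rw [prob, Finset.sum_mul]
  refine Finset.sum_le_sum fun b _ => ?_
  by_cases hb : A.output b ∈ S
  · rw [Set.indicator_of_mem (s := A.output ⁻¹' S) hb]
    exact mul_le_mul_of_nonneg_left (hR _ hb) (by positivity)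
  · rw [Set.indicator_of_notMem (s := A.output ⁻¹' S) hb, zero_mul]
    exact mul_nonneg (by positivity) (prob_nonneg _ _ _)

/-- If `R` never leads out of `T ⊆ S`, and leads from each element of `S` to `T` with probability at
least `q`, then one run of `R` moves at least a fraction `q` of the probability of `S \ T` to `T`. -/
theorem prob_bind_subset {S T : Set ℝ} {q : ℝ} (hTS : T ⊆ S)
    (hT : ∀ v ∈ T, (R.at v).prob x T = 1) (hR : ∀ v ∈ S, q ≤ (R.at v).prob x T) :
    A.prob x T + q * (A.prob x S - A.prob x T) ≤ (A.bind R).prob x T := by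
  rw [prob_bind, prob, prob, ← Finset.sum_sub_distrib, Finset.mul_sum, ← Finset.sum_add_distrib]
  refine Finset.sum_le_sum fun b _ => ?_
  by_cases hb : A.output b ∈ T
  · rw [Set.indicator_of_mem (s := A.output ⁻¹' T) hb,
      Set.indicator_of_mem (s := A.output ⁻¹' S) (hTS hb), hT _ hb]
    simp
  rw [Set.indicator_of_notMem (s := A.output ⁻¹' T) hb]
  by_cases hs : A.output b ∈ S
  · rw [Set.indicator_of_mem (s := A.output ⁻¹' S) hs]
    have := mul_le_mul_of_nonneg_left (hR _ hs) (sq_nonneg ‖A.state x A.queries b‖)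
    linarith
  · rw [Set.indicator_of_notMem (s := A.output ⁻¹' S) hs]
    have := mul_nonneg (sq_nonneg ‖A.state x A.queries b‖) (prob_nonneg (R.at (A.output b)) x T)
    linarith

end QueryAlgorithm

/-! ### The quantum walk in a two-dimensional space -/

/-- The reflection `2 |ψ⟩⟨ψ| - 1` about a unit vector. -/
def reflection {L : Type*} [Fintype L] [DecidableEq L] (ψ : L → ℂ) (h : ∑ b, ‖ψ b‖ ^ 2 = 1) :
    unitaryGroup L ℂ :=
  ⟨(2 : ℂ) • vecMulVec ψ (star ψ) - 1, by
    have hs : star ψ ⬝ᵥ ψ = 1 := by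
      have : ((∑ b, ‖ψ b‖ ^ 2 : ℝ) : ℂ) = star ψ ⬝ᵥ ψ := by
        push_cast
        refine Finset.sum_congr rfl fun b _ => ?_
        rw [Pi.star_apply, ← Complex.conj_mul']
        rfl
      rw [← this, h, Complex.ofReal_one]
    have hH : star ((2 : ℂ) • vecMulVec ψ (star ψ) - 1) = (2 : ℂ) • vecMulVec ψ (star ψ) - 1 := by
      simp [star_eq_conjTranspose, conjTranspose_vecMulVec]
    have hP : vecMulVec ψ (star ψ) * vecMulVec ψ (star ψ) = vecMulVec ψ (star ψ) := by
      rw [vecMulVec_mul_vecMulVec, hs, one_smul]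
    rw [mem_unitaryGroup_iff, hH, sub_mul, mul_sub, mul_sub, smul_mul_smul_comm, hP]
    simp only [mul_one, one_mul]
    module⟩

theorem reflection_mulVec {L : Type*} [Fintype L] [DecidableEq L] (ψ : L → ℂ)
    (h : ∑ b, ‖ψ b‖ ^ 2 = 1) (φ : L → ℂ) :
    (reflection ψ h).1 *ᵥ φ = (2 * (star ψ ⬝ᵥ φ)) • ψ - φ := by
  rw [reflection, sub_mulVec, one_mulVec, smul_mulVec, vecMulVec_mulVec]
  ext b
  simp [mul_comm, mul_left_comm]

/-- The reflection of a qubit that sends `|0⟩` to `cos t |0⟩ + sin t |1⟩`. -/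
def qubitReflection (t : ℝ) : unitaryGroup Bool ℂ :=
  ⟨Matrix.of fun e e' => ((if e = e' then (if e then -Real.cos t else Real.cos t)
      else Real.sin t : ℝ) : ℂ), by
    have h : (Real.cos t : ℂ) * Real.cos t + Real.sin t * Real.sin t = 1 := by
      have := Real.cos_sq_add_sin_sq t
      rw [sq, sq] at this
      exact_mod_cast this
    rw [mem_unitaryGroup_iff]
    ext e e'
    cases e <;> cases e' <;> simp [mul_apply, star_apply, -Complex.ofReal_cos, -Complex.ofReal_sin]
    · linear_combination h
    · ring
    · ring
    · linear_combination h⟩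

theorem qubitReflection_mulVec_mulVec (t : ℝ) (φ : Bool → ℂ) :
    (qubitReflection t).1 *ᵥ ((qubitReflection t).1 *ᵥ φ) = φ := by
  have h : (Real.cos t : ℂ) * Real.cos t + Real.sin t * Real.sin t = 1 := by
    have := Real.cos_sq_add_sin_sq t
    rw [sq, sq] at this
    exact_mod_cast this
  ext e
  cases e <;> simp [qubitReflection, mulVec, dotProduct, -Complex.ofReal_cos, -Complex.ofReal_sin]
  · linear_combination φ false * h
  · linear_combination φ true * h

/-- The state `|i⟩|0⟩|0⟩` in uniform superposition over the indices `i`. -/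
def uniformState (d l : ℕ) : Label d l Bool → ℂ := fun b =>
  if b.2 = ((fun _ => false), false) then ((1 / √(d : ℝ) : ℝ) : ℂ) else 0

theorem sum_norm_sq_uniformState [NeZero d] : ∑ b, ‖uniformState d l b‖ ^ 2 = 1 := by
  rw [Fintype.sum_prod_type]
  have h : ∀ i : Fin d, ∑ c, ‖uniformState d l (i, c)‖ ^ 2 = 1 / d := by
    intro i
    rw [Finset.sum_eq_single ((fun _ => false), false)]
    · simp [uniformState]
    · intro c _ hc
      simp [uniformState, hc]
    · simp
  simp [h]

/-- The index and answer registers, split off from the ancilla qubit. -/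
def splitAncilla (d l : ℕ) : Label d l Bool ≃ Bool × (Fin d × BitString l) where
  toFun b := (b.2.2, (b.1, b.2.1))
  invFun c := (c.2.1, c.2.2, c.1)
  left_inv _ := rfl
  right_inv _ := rfl

/-- The reflection of the ancilla by an angle that depends on the answer register. -/
def answerGate (d : ℕ) (t : BitString l → ℝ) : unitaryGroup (Label d l Bool) ℂ :=
  ctrl (splitAncilla d l) fun c => qubitReflection (t c.2)

/-- The reflection about the uniform state. -/
def uniformGate (d l : ℕ) [NeZero d] : unitaryGroup (Label d l Bool) ℂ :=
  reflection (uniformState d l) sum_norm_sq_uniformState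

/-- The ancilla reflection by the angle of the queried value: query, reflect, and uncompute. -/
def valueReflection (t : BitString l → ℝ) (x : Fin d → BitString l) (φ : Label d l Bool → ℂ) :
    Label d l Bool → ℂ :=
  oracle Bool x *ᵥ ((answerGate d t).1 *ᵥ (oracle Bool x *ᵥ φ))

theorem valueReflection_apply (t : BitString l → ℝ) (x : Fin d → BitString l)
    (φ : Label d l Bool → ℂ) (i : Fin d) (z : BitString l) (e : Bool) :
    valueReflection t x φ (i, z, e) =
      ((qubitReflection (t fun k => xor (z k) (x i k))).1 *ᵥ fun e' => φ (i, z, e')) e := by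
  rw [valueReflection, oracle_mulVec]
  refine (ctrl_mulVec (splitAncilla d l) _ _ e (i, fun k => xor (z k) (x i k))).trans ?_
  congr 1
  funext e'
  rw [oracle_mulVec]
  exact congrArg φ (queryLabel_involutive x (i, z, e'))

theorem valueReflection_valueReflection (t : BitString l → ℝ) (x : Fin d → BitString l)
    (φ : Label d l Bool → ℂ) : valueReflection t x (valueReflection t x φ) = φ := by
  funext ⟨i, z, e⟩
  simp only [valueReflection_apply, qubitReflection_mulVec_mulVec]

theorem valueReflection_add (t : BitString l → ℝ) (x : Fin d → BitString l)
    (φ χ : Label d l Bool → ℂ) :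
    valueReflection t x (φ + χ) = valueReflection t x φ + valueReflection t x χ := by
  simp only [valueReflection, mulVec_add]

theorem valueReflection_smul (t : BitString l → ℝ) (x : Fin d → BitString l) (a : ℂ)
    (φ : Label d l Bool → ℂ) :
    valueReflection t x (a • φ) = a • valueReflection t x φ := by
  simp only [valueReflection, mulVec_smul]

theorem sum_norm_sq_valueReflection (t : BitString l → ℝ) (x : Fin d → BitString l)
    (φ : Label d l Bool → ℂ) : ∑ b, ‖valueReflection t x φ b‖ ^ 2 = ∑ b, ‖φ b‖ ^ 2 := by
  rw [valueReflection, sum_norm_sq_oracle, sum_norm_sq_mulVec, sum_norm_sq_oracle]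

/-- The value reflection takes the uniform state to
`∑ i, |i⟩|0⟩ (cos (t (x i)) |0⟩ + sin (t (x i)) |1⟩)`, up to normalization. -/
theorem valueReflection_uniformState (t : BitString l → ℝ) (x : Fin d → BitString l) (i : Fin d)
    (z : BitString l) (e : Bool) :
    valueReflection t x (uniformState d l) (i, z, e) =
      if z = fun _ => false then
        (((if e then Real.sin (t (x i)) else Real.cos (t (x i))) / √(d : ℝ) : ℝ) : ℂ) else 0 := by
  rw [valueReflection_apply]
  by_cases hz : z = fun _ => false
  · subst hz
    cases e <;> simp [qubitReflection, mulVec, dotProduct, uniformState, div_eq_mul_inv]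
  · simp [mulVec, dotProduct, uniformState, hz]

theorem uniformState_dotProduct_valueReflection (t : BitString l → ℝ) (x : Fin d → BitString l) :
    star (uniformState d l) ⬝ᵥ valueReflection t x (uniformState d l) =
      ((mean fun i => Real.cos (t (x i)) : ℝ) : ℂ) := by
  have hd : (√(d : ℝ) : ℂ) * √(d : ℝ) = d := by
    rw [← Complex.ofReal_mul, Real.mul_self_sqrt (Nat.cast_nonneg d), Complex.ofReal_natCast]
  rw [dotProduct, Fintype.sum_prod_type, mean]
  push_cast
  rw [Finset.mul_sum]
  refine Finset.sum_congr rfl fun i _ => ?_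
  rw [Finset.sum_eq_single ((fun _ => false), false)]
  · rw [valueReflection_uniformState]
    simp only [Pi.star_apply, uniformState, if_pos, Bool.false_eq_true, if_false]
    push_cast
    rw [← hd]
    simp [div_eq_mul_inv]
    ring
  · intro c _ hc
    simp [uniformState, hc]
  · simp

/-- The states of the walk generated by the reflection about the uniform state, followed by the value
reflection. -/
def walk [NeZero d] (t : BitString l → ℝ) (x : Fin d → BitString l) : ℕ → Label d l Bool → ℂ
  | 0 => uniformState d l
  | m + 1 => valueReflection t x ((uniformGate d l).1 *ᵥ walk t x m)

section Walk

variable [NeZero d] (t : BitString l → ℝ) (x : Fin d → BitString l)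

theorem sum_norm_sq_walk (m : ℕ) : ∑ b, ‖walk t x m b‖ ^ 2 = 1 := by
  induction m with
  | zero => exact sum_norm_sq_uniformState
  | succ m ih => rw [walk, sum_norm_sq_valueReflection, sum_norm_sq_mulVec, ih]

theorem uniformState_dotProduct_self : star (uniformState d l) ⬝ᵥ uniformState d l = 1 := by
  rw [dotProduct, ← Complex.ofReal_one, ← sum_norm_sq_uniformState (d := d) (l := l)]
  push_cast
  refine Finset.sum_congr rfl fun b _ => ?_
  rw [Pi.star_apply, ← Complex.conj_mul']
  rfl

theorem walk_one : walk t x 1 = valueReflection t x (uniformState d l) := by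
  rw [walk, walk, uniformGate, reflection_mulVec, uniformState_dotProduct_self]
  congr 1
  module

/-- The walk is a rotation in a plane: its states satisfy the recurrence of the Chebyshev
polynomials, at the mean of the cosines. -/
theorem walk_add_two (m : ℕ) :
    walk t x (m + 2) + walk t x m =
      (2 * ((mean fun i => Real.cos (t (x i)) : ℝ) : ℂ)) • walk t x (m + 1) := by
  induction m with
  | zero =>
    have h2 : walk t x 2 = valueReflection t x ((uniformGate d l).1 *ᵥ walk t x 1) := rfl
    have h0 : walk t x 0 = uniformState d l := rfl
    rw [Nat.zero_add, Nat.zero_add, h2, h0, walk_one, uniformGate, reflection_mulVec,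
      uniformState_dotProduct_valueReflection, sub_eq_add_neg,
      ← neg_one_smul ℂ (valueReflection _ _ _),
      valueReflection_add, valueReflection_smul, valueReflection_smul,
      valueReflection_valueReflection]
    module
  | succ m ih =>
    have h : walk t x (m + 3) + walk t x (m + 1) =
        valueReflection t x ((uniformGate d l).1 *ᵥ (walk t x (m + 2) + walk t x m)) := by
      rw [mulVec_add, valueReflection_add]
      rfl
    rw [show m + 1 + 2 = m + 3 from rfl, h, ih, mulVec_smul, valueReflection_smul]
    rfl

/-- The walk never leaves the answer register in a nonzero state. -/
theorem walk_eq_zero (m : ℕ) (i : Fin d) {z : BitString l} (hz : z ≠ fun _ => false) (e : Bool) :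
    walk t x m (i, z, e) = 0 := by
  induction m using Nat.twoStepInduction with
  | zero => simp [walk, uniformState, hz]
  | one => rw [walk_one, valueReflection_uniformState, if_neg hz]
  | more m h0 h1 =>
    have h := congrFun (walk_add_two t x m) (i, z, e)
    simpa [h0, h1] using h

/-- The amplitudes of the walk on the states with ancilla `1`. -/
theorem walk_true (m : ℕ) (i : Fin d) {φ : ℝ}
    (hφ : Real.cos φ = mean fun i => Real.cos (t (x i))) :
    Real.sin φ * walk t x m (i, (fun _ => false), true) =
      ((Real.sin (m * φ) * Real.sin (t (x i)) / √(d : ℝ) : ℝ) : ℂ) := by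
  induction m using Nat.twoStepInduction with
  | zero => simp [walk, uniformState]
  | one =>
    rw [walk_one, valueReflection_uniformState]
    simp only [if_true]
    push_cast
    ring_nf
  | more m h0 h1 =>
    have h := congrFun (walk_add_two t x m) (i, (fun _ => false), true)
    rw [← hφ] at h
    simp only [Pi.add_apply, Pi.smul_apply, smul_eq_mul] at h
    have hs : Real.sin ((m + 2 : ℕ) * φ) + Real.sin (m * φ) =
        2 * Real.cos φ * Real.sin ((m + 1 : ℕ) * φ) := by
      push_cast
      rw [show (m + 2 : ℝ) * φ = (m + 1) * φ + φ by ring,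
        show (m : ℝ) * φ = (m + 1) * φ - φ by ring, Real.sin_add, Real.sin_sub]
      ring
    have hs' : ((Real.sin ((m + 2 : ℕ) * φ) * Real.sin (t (x i)) / √(d : ℝ) : ℝ) : ℂ) =
        2 * Real.cos φ * ((Real.sin ((m + 1 : ℕ) * φ) * Real.sin (t (x i)) / √(d : ℝ) : ℝ) : ℂ) -
          ((Real.sin (m * φ) * Real.sin (t (x i)) / √(d : ℝ) : ℝ) : ℂ) := by
      rw [eq_sub_of_add_eq hs]
      push_cast
      ring
    rw [hs', ← h0, ← h1]
    linear_combination (Real.sin φ : ℂ) * h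

end Walk

/-! ### The walk with a superposed number of steps -/

/-- The counter `Fin n`, split off from the registers of the walk. -/
def splitCounter (d l n : ℕ) : Label d l (Fin n × Bool) ≃ Label d l Bool × Fin n where
  toFun b := ((b.1, b.2.1, b.2.2.2), b.2.2.1)
  invFun c := (c.1.1, c.1.2.1, c.2, c.1.2.2)
  left_inv _ := rfl
  right_inv _ := rfl

/-- The gate `U`, applied when the counter is at least `j`. -/
def fromCounter {n : ℕ} (j : ℕ) (U : unitaryGroup (Label d l Bool) ℂ) :
    unitaryGroup (Label d l (Fin n × Bool)) ℂ :=
  ctrl (splitCounter d l n) fun k => if j ≤ k then U else 1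

theorem fromCounter_mulVec {n : ℕ} (j : ℕ) (U : unitaryGroup (Label d l Bool) ℂ)
    (Φ : Label d l (Fin n × Bool) → ℂ) (k : Fin n) :
    (fun b => ((fromCounter j U).1 *ᵥ Φ) ((splitCounter d l n).symm (b, k))) =
      if j ≤ k then U.1 *ᵥ fun b => Φ ((splitCounter d l n).symm (b, k))
      else fun b => Φ ((splitCounter d l n).symm (b, k)) := by
  funext b
  rw [fromCounter, ctrl_mulVec]
  split_ifs
  · rfl
  · rw [UnitaryGroup.one_val, one_mulVec]

theorem oracle_mulVec_counter {n : ℕ} (x : Fin d → BitString l)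
    (Φ : Label d l (Fin n × Bool) → ℂ) (k : Fin n) :
    (fun b => (oracle (Fin n × Bool) x *ᵥ Φ) ((splitCounter d l n).symm (b, k))) =
      oracle Bool x *ᵥ fun b => Φ ((splitCounter d l n).symm (b, k)) := by
  funext b
  rw [oracle_mulVec, oracle_mulVec]
  rfl

/-- The superposition of the states of the walk over the counter, with weights `w`, after `j` rounds:
if the counter is `k`, then the walk has made `min j (k + 1)` steps. -/
def counterState [NeZero d] {n : ℕ} (w : Fin n → ℝ) (t : BitString l → ℝ) (x : Fin d → BitString l)
    (j : ℕ) : Label d l (Fin n × Bool) → ℂ := fun b =>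
  w b.2.2.1 * walk t x (min j (b.2.2.1 + 1)) (b.1, b.2.1, b.2.2.2)

/-- One round advances the walk by one step if the counter allows it; otherwise the two queries of
the round cancel. -/
theorem round_counterState [NeZero d] {n : ℕ} (w : Fin n → ℝ) (t : BitString l → ℝ)
    (x : Fin d → BitString l) (j : ℕ) :
    oracle (Fin n × Bool) x *ᵥ ((fromCounter j (answerGate d t)).1 *ᵥ (oracle (Fin n × Bool) x *ᵥ
      ((fromCounter j (uniformGate d l)).1 *ᵥ counterState w t x j))) =
      counterState w t x (j + 1) := by
  have key : ∀ k : Fin n, (fun b => (oracle (Fin n × Bool) x *ᵥ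
      ((fromCounter j (answerGate d t)).1 *ᵥ (oracle (Fin n × Bool) x *ᵥ
        ((fromCounter j (uniformGate d l)).1 *ᵥ counterState w t x j))))
          ((splitCounter d l n).symm (b, k))) =
      fun b => counterState w t x (j + 1) ((splitCounter d l n).symm (b, k)) := by
    intro k
    have hs : ∀ i, (fun b => counterState w t x i ((splitCounter d l n).symm (b, k))) =
        (w k : ℂ) • walk t x (min i (k + 1)) := fun i => rfl
    rw [oracle_mulVec_counter, fromCounter_mulVec, oracle_mulVec_counter, fromCounter_mulVec, hs, hs]
    split_ifs with hj
    · rw [min_eq_left (by omega), min_eq_left (by omega)]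
      simp only [mulVec_smul]
      rfl
    · rw [min_eq_right (by omega), min_eq_right (by omega)]
      funext b
      rw [oracle_mulVec, oracle_mulVec, queryLabel_involutive]
  funext b
  obtain ⟨⟨b, k⟩, rfl⟩ := (splitCounter d l n).symm.surjective b
  exact congrFun (key k) b

theorem sum_norm_sq_counterState [NeZero d] {n : ℕ} {w : Fin n → ℝ} (hw : ∑ k, w k ^ 2 = 1)
    (t : BitString l → ℝ) (x : Fin d → BitString l) (j : ℕ) :
    ∑ b, ‖counterState w t x j b‖ ^ 2 = 1 := by
  rw [← (splitCounter d l n).symm.sum_comp, Fintype.sum_prod_type, Finset.sum_comm, ← hw]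
  refine Finset.sum_congr rfl fun k _ => ?_
  have h : ∀ b, ‖counterState w t x j ((splitCounter d l n).symm (b, k))‖ ^ 2 =
      w k ^ 2 * ‖walk t x (min j (k + 1)) b‖ ^ 2 := by
    intro b
    change ‖(w k : ℂ) * walk t x (min j (k + 1)) b‖ ^ 2 = _
    rw [norm_mul, mul_pow, Complex.norm_real, Real.norm_eq_abs, sq_abs]
  simp only [h, ← Finset.mul_sum, sum_norm_sq_walk, mul_one]

/-- In the initial superposition no step has been made, so it does not depend on the table: the table
of zeros serves to write it down. -/
theorem exists_prepare [NeZero d] {n : ℕ} [NeZero n] {w : Fin n → ℝ} (hw : ∑ k, w k ^ 2 = 1) :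
    ∃ U : unitaryGroup (Label d l (Fin n × Bool)) ℂ,
      U.1 *ᵥ Pi.single (0, (fun _ => false), 0, false) 1 =
        counterState w (fun _ => 0) (fun _ _ => false) 0 :=
  exists_gate_single _ _ (sum_norm_sq_counterState hw _ _ _)

/-- The gates of the walk with counter: preparation, `n` rounds of the reflection about the uniform
state, a query, the ancilla reflection and a query, and, after one more query, the gate `F`. -/
def counterGate [NeZero d] {n : ℕ} [NeZero n] {w : Fin n → ℝ} (hw : ∑ k, w k ^ 2 = 1)
    (t : BitString l → ℝ) (F : unitaryGroup (Label d l (Fin n × Bool)) ℂ) (s : ℕ) :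
    unitaryGroup (Label d l (Fin n × Bool)) ℂ :=
  if s = 2 * n + 1 then F
  else if s = 0 then fromCounter 0 (uniformGate d l) * (exists_prepare hw).choose
  else if s % 2 = 0 then fromCounter (s / 2) (uniformGate d l)
  else fromCounter (s / 2) (answerGate d t)

section Counter

variable [NeZero d] {n : ℕ} [NeZero n] {w : Fin n → ℝ} (hw : ∑ k, w k ^ 2 = 1)
  (t : BitString l → ℝ) (F : unitaryGroup (Label d l (Fin n × Bool)) ℂ) (x : Fin d → BitString l)

theorem evolve_counterGate_even (j : ℕ) (hj : j ≤ n) :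
    evolve (counterGate hw t F) (Pi.single (0, (fun _ => false), 0, false) 1) x (2 * j) =
      (fromCounter j (uniformGate d l)).1 *ᵥ counterState w t x j := by
  induction j with
  | zero =>
    have hg : counterGate hw t F 0 = fromCounter 0 (uniformGate d l) * (exists_prepare hw).choose :=
      (if_neg (by omega)).trans (if_pos rfl)
    have hs : counterState w t x 0 = counterState w (fun _ : BitString l => 0)
        (fun (_ : Fin d) _ => false) 0 := by
      funext b
      simp [counterState, walk]
    rw [Nat.mul_zero, evolve, hg, UnitaryGroup.mul_val, ← mulVec_mulVec,
      (exists_prepare hw).choose_spec, hs]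
  | succ j ih =>
    have h1 : counterGate hw t F (2 * j + 1) = fromCounter j (answerGate d t) := by
      rw [counterGate, if_neg (by omega), if_neg (by omega), if_neg (by omega)]
      congr 1
      omega
    have h2 : counterGate hw t F (2 * j + 1 + 1) = fromCounter (j + 1) (uniformGate d l) := by
      rw [counterGate, if_neg (by omega), if_neg (by omega), if_pos (by omega)]
      congr 1
      omega
    rw [show 2 * (j + 1) = 2 * j + 1 + 1 by ring, evolve, evolve, ih (by omega), h1, h2,
      round_counterState]

/-- The final state of the walk with counter. -/
theorem evolve_counterGate :
    evolve (counterGate hw t F) (Pi.single (0, (fun _ => false), 0, false) 1) x (2 * n + 1) =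
      F.1 *ᵥ fun b =>
        (w b.2.2.1 : ℂ) *
          walk t x (b.2.2.1 + 1) (b.1, (fun k => xor (b.2.1 k) (x b.1 k)), b.2.2.2) := by
  have hg : counterGate hw t F (2 * n + 1) = F := if_pos rfl
  rw [evolve, evolve_counterGate_even hw t F x n le_rfl, hg]
  congr 1
  funext b
  rw [oracle_mulVec]
  have h := congrFun (fromCounter_mulVec n (uniformGate d l) (counterState w t x n) b.2.2.1)
    (queryLabel x (b.1, b.2.1, b.2.2.2))
  rw [if_neg (by omega)] at h
  refine h.trans ?_
  change (w b.2.2.1 : ℂ) * walk t x (min n (b.2.2.1 + 1)) _ = _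
  rw [min_eq_right (by omega)]
  rfl

end Counter

/-- The routine that runs the walk with counter. -/
def walkRoutine [NeZero d] {n : ℕ} [NeZero n] {w : Fin n → ℝ} (hw : ∑ k, w k ^ 2 = 1)
    (t : ℝ → BitString l → ℝ) (F : unitaryGroup (Label d l (Fin n × Bool)) ℂ)
    (out : ℝ → Label d l (Fin n × Bool) → ℝ) : Routine d l where
  W := Fin n × Bool
  start := (0, (fun _ => false), 0, false)
  queries := 2 * n + 1
  gate v := counterGate hw (t v) F
  output := out

theorem state_walkRoutine [NeZero d] {n : ℕ} [NeZero n] {w : Fin n → ℝ} (hw : ∑ k, w k ^ 2 = 1)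
    (t : ℝ → BitString l → ℝ) (F : unitaryGroup (Label d l (Fin n × Bool)) ℂ)
    (out : ℝ → Label d l (Fin n × Bool) → ℝ) (v : ℝ) (x : Fin d → BitString l) :
    ((walkRoutine hw t F out).at v).state x (2 * n + 1) =
      F.1 *ᵥ fun b =>
        (w b.2.2.1 : ℂ) *
          walk (t v) x (b.2.2.1 + 1) (b.1, (fun k => xor (b.2.1 k) (x b.1 k)), b.2.2.2) := by
  rw [QueryAlgorithm.state_eq_evolve]
  exact evolve_counterGate hw (t v) F x

/-! ### Search for a larger value -/

theorem quarter_le_sum_sin_sq {φ : ℝ} {n : ℕ} (h0 : 0 < Real.sin φ) (h : 1 ≤ n * Real.sin φ) :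
    (n : ℝ) / 4 ≤ ∑ k : Fin n, Real.sin ((k + 1 : ℕ) * φ) ^ 2 := by
  have key : ∀ m : ℕ, 4 * Real.sin φ * ∑ k ∈ Finset.range m, Real.sin ((k + 1 : ℕ) * φ) ^ 2 =
      2 * m * Real.sin φ - (Real.sin ((2 * m + 1) * φ) - Real.sin φ) := by
    intro m
    induction m with
    | zero => simp
    | succ m ih =>
      rw [Finset.sum_range_succ, mul_add, ih]
      push_cast
      rw [show (2 * ((m : ℝ) + 1) + 1) * φ = 2 * ((m + 1) * φ) + φ by ring,
        show (2 * (m : ℝ) + 1) * φ = 2 * ((m + 1) * φ) - φ by ring, Real.sin_add, Real.sin_sub,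
        Real.cos_two_mul, Real.cos_sq']
      ring
  have h1 := key n
  rw [Fin.sum_univ_eq_sum_range fun k => Real.sin ((k + 1 : ℕ) * φ) ^ 2]
  have h2 := Real.sin_le_one ((2 * n + 1) * φ)
  refine le_of_mul_le_mul_left ?_ (by positivity : 0 < 4 * Real.sin φ)
  nlinarith

/-- The angle that marks the strings whose value exceeds `v`. -/
def markAngle (val : BitString l → ℝ) (v : ℝ) (z : BitString l) : ℝ :=
  if v < val z then Real.pi / 2 else 0

theorem sum_uniform_weight_sq (n : ℕ) [NeZero n] : ∑ _k : Fin n, (1 / √(n : ℝ)) ^ 2 = 1 := by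
  simp

/-- One step of maximum finding: a search for a value that exceeds the parameter `v`, with a number
of walk steps in uniform superposition. The output is the larger of `v` and the value found. -/
def raise (d : ℕ) [NeZero d] (val : BitString l → ℝ) (n : ℕ) [NeZero n] : Routine d l :=
  walkRoutine (sum_uniform_weight_sq n) (markAngle val) 1 fun v b => max (val b.2.1) v

/-- The number of indices whose value exceeds `v`. -/
def rank (F : Fin d → ℝ) (v : ℝ) : ℕ := (Finset.univ.filter fun i => v < F i).card

theorem rank_anti (F : Fin d → ℝ) {v v' : ℝ} (h : v ≤ v') : rank F v' ≤ rank F v :=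
  Finset.card_le_card fun i hi => by
    rw [Finset.mem_filter] at hi ⊢
    exact ⟨hi.1, h.trans_lt hi.2⟩

/-- At least `t` of the values have rank less than `t`. -/
theorem le_card_rank_lt (F : Fin d → ℝ) {t : ℕ} (ht : t ≤ d) :
    t ≤ (Finset.univ.filter fun i => rank F (F i) < t).card := by
  by_contra! hlt
  set S := Finset.univ.filter fun i => rank F (F i) < t with hS
  have hne : (Sᶜ).Nonempty := by
    rw [← Finset.card_pos, Finset.card_compl, Fintype.card_fin]
    omega
  -- A largest value outside of the top ones is exceeded by top values only.
  obtain ⟨i, hi, hmax⟩ := Finset.exists_max_image Sᶜ F hne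
  have hle : rank F (F i) ≤ S.card := Finset.card_le_card fun j hj => by
    by_contra hjS
    exact absurd (hmax j (Finset.mem_compl.2 hjS)) (not_le.2 (Finset.mem_filter.1 hj).2)
  refine Finset.mem_compl.1 hi (Finset.mem_filter.2 ⟨Finset.mem_univ _, ?_⟩)
  omega

section Raise

variable [NeZero d] (val : BitString l → ℝ) (n : ℕ) [NeZero n] (v : ℝ) (x : Fin d → BitString l)

theorem state_raise (b : Label d l (Fin n × Bool)) :
    ((raise d val n).at v).state x (2 * n + 1) b =
      ((1 / √(n : ℝ) : ℝ) : ℂ) * walk (markAngle val v) x (b.2.2.1 + 1)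
        (b.1, (fun k => xor (b.2.1 k) (x b.1 k)), b.2.2.2) := by
  refine (congrFun (state_walkRoutine (sum_uniform_weight_sq n) (markAngle val) 1 _ v x) b).trans ?_
  rw [UnitaryGroup.one_val, one_mulVec]

/-- The output of a step is the larger of `v` and some value of the table. -/
theorem prob_raise_eq_one {S : Set ℝ} (h : ∀ i, max (val (x i)) v ∈ S) :
    ((raise d val n).at v).prob x S = 1 := by
  refine QueryAlgorithm.prob_eq_one _ _ fun b hb => ?_
  have hz : b.2.1 = x b.1 := by
    by_contra hz
    refine hb ?_
    refine (state_raise val n v x b).trans ?_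
    rw [walk_eq_zero, mul_zero]
    intro h0
    refine hz (funext fun k => ?_)
    have := congrFun h0 k
    simpa using this
  change max (val b.2.1) v ∈ S
  rw [hz]
  exact h _

/-- If there are `r` values above `v` and `n` is at least `√(d / r)`, then each of them is found with
probability at least `1 / (8 r)`. -/
theorem le_prob_raise {S : Set ℝ} (G : Finset (Fin d)) (hG : ∀ i ∈ G, v < val (x i) ∧ val (x i) ∈ S)
    (hr : 0 < rank (fun i => val (x i)) v) (hn : d ≤ n ^ 2 * rank (fun i => val (x i)) v) :
    (G.card : ℝ) / (8 * rank (fun i => val (x i)) v) ≤ ((raise d val n).at v).prob x S := by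
  set r := rank (fun i => val (x i)) v with hr_def
  have hd0 : (0 : ℝ) < d := Nat.cast_pos.2 (NeZero.pos d)
  have hn0 : (0 : ℝ) < n := Nat.cast_pos.2 (NeZero.pos n)
  have hr0 : (0 : ℝ) < r := Nat.cast_pos.2 hr
  have hrd : (r : ℝ) ≤ d := by
    have : r ≤ d := (Finset.card_le_univ _).trans_eq (Fintype.card_fin d)
    exact_mod_cast this
  set p : ℝ := r / d with hp
  have hp0 : 0 < p := by positivity
  have hp1 : p ≤ 1 := (div_le_one hd0).2 hrd
  set φ := Real.arccos (1 - p) with hφ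
  have hcos : Real.cos φ = 1 - p := Real.cos_arccos (by linarith) (by linarith)
  have hmean : Real.cos φ = mean fun i => Real.cos (markAngle val v (x i)) := by
    have h1 : ∀ i, Real.cos (markAngle val v (x i)) = 1 - if v < val (x i) then 1 else 0 := by
      intro i
      unfold markAngle
      split_ifs <;> simp
    rw [hcos, mean]
    simp only [h1, Finset.sum_sub_distrib, Finset.sum_boole]
    rw [hp, hr_def, rank]
    simp
    field_simp
  have hsin_sq : Real.sin φ ^ 2 = p * (2 - p) := by
    rw [Real.sin_sq, hcos]
    ring
  have hsin_nonneg : 0 ≤ Real.sin φ := Real.sin_nonneg_of_nonneg_of_le_pi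
    (Real.arccos_nonneg _) (Real.arccos_le_pi _)
  have hnp : 1 ≤ (n : ℝ) ^ 2 * p := by
    rw [hp, mul_div_assoc', le_div_iff₀ hd0, one_mul]
    exact_mod_cast hn
  have hnsin : 1 ≤ n * Real.sin φ := by
    rw [← one_le_sq_iff₀ (by positivity), mul_pow, hsin_sq]
    nlinarith [mul_nonneg (sq_nonneg (n : ℝ)) (mul_nonneg hp0.le (sub_nonneg.2 hp1))]
  have hsin0 : 0 < Real.sin φ := by
    refine lt_of_le_of_ne hsin_nonneg fun h => ?_
    rw [← h] at hnsin
    norm_num at hnsin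
  have hsum := quarter_le_sum_sin_sq hsin0 hnsin
  -- The amplitude of a marked index with ancilla `1`.
  have hamp : ∀ i ∈ G, ∀ k : Fin n, Real.sin ((k + 1 : ℕ) * φ) ^ 2 / (2 * r * n) ≤
      ‖((raise d val n).at v).state x (2 * n + 1) (i, x i, k, true)‖ ^ 2 := by
    intro i hi k
    have h1 := walk_true (markAngle val v) x (k + 1) i hmean
    have h2 : Real.sin (markAngle val v (x i)) = 1 := by
      rw [markAngle, if_pos (hG i hi).1, Real.sin_pi_div_two]
    have h3 : Real.sin φ ^ 2 * ‖walk (markAngle val v) x (k + 1) (i, (fun _ => false), true)‖ ^ 2 =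
        Real.sin ((k + 1 : ℕ) * φ) ^ 2 / d := by
      have := congrArg (fun c => ‖c‖ ^ 2) h1
      simp only [norm_mul, mul_pow, Complex.norm_real, Real.norm_eq_abs, sq_abs, h2, mul_one,
        div_pow, Real.sq_sqrt hd0.le] at this
      exact this
    refine le_of_le_of_eq ?_
      (congrArg (fun c => ‖c‖ ^ 2) (state_raise val n v x (i, x i, k, true))).symm
    simp only [Bool.xor_self]
    rw [norm_mul, mul_pow, Complex.norm_real, Real.norm_eq_abs, sq_abs, div_pow, one_pow,
      Real.sq_sqrt hn0.le]
    set y := ‖walk (markAngle val v) x (k + 1) (i, (fun _ => false), true)‖ ^ 2 with hy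
    have hy0 : 0 ≤ y := by positivity
    have h4 : Real.sin ((k + 1 : ℕ) * φ) ^ 2 ≤ 2 * r * y := by
      have h5 : Real.sin ((k + 1 : ℕ) * φ) ^ 2 = d * (Real.sin φ ^ 2 * y) := by
        rw [h3]
        field_simp
      have h6 : (d : ℝ) * p = r := by
        rw [hp]
        field_simp
      rw [h5, hsin_sq]
      calc (d : ℝ) * (p * (2 - p) * y) = (d * p) * ((2 - p) * y) := by ring
        _ ≤ r * (2 * y) := by
            rw [h6]
            gcongr
            linarith
        _ = 2 * r * y := by ring
    calc Real.sin ((k + 1 : ℕ) * φ) ^ 2 / (2 * r * n) ≤ 2 * r * y / (2 * r * n) := by gcongr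
      _ = 1 / n * y := by field_simp
  have hinj : Function.Injective fun q : Fin d × Fin n =>
      ((q.1, x q.1, q.2, true) : Label d l (Fin n × Bool)) := by
    rintro ⟨i, k⟩ ⟨i', k'⟩ h
    simp only [Prod.mk.injEq] at h
    rw [h.1, h.2.2.1]
  calc (G.card : ℝ) / (8 * r) = ∑ i ∈ G, (n / 4 : ℝ) / (2 * r * n) := by
        rw [Finset.sum_const, nsmul_eq_mul]
        field_simp
        ring
    _ ≤ ∑ i ∈ G, ∑ k : Fin n, Real.sin ((k + 1 : ℕ) * φ) ^ 2 / (2 * r * n) := by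
        refine Finset.sum_le_sum fun i _ => ?_
        rw [← Finset.sum_div]
        gcongr
    _ ≤ ∑ i ∈ G, ∑ k : Fin n,
          ((fun b : Label d l (Fin n × Bool) => max (val b.2.1) v) ⁻¹' S).indicator
            (fun b => ‖((raise d val n).at v).state x (2 * n + 1) b‖ ^ 2) (i, x i, k, true) := by
        refine Finset.sum_le_sum fun i hi => Finset.sum_le_sum fun k _ => ?_
        have hmem : ((i, x i, k, true) : Label d l (Fin n × Bool)) ∈
            (fun b : Label d l (Fin n × Bool) => max (val b.2.1) v) ⁻¹' S := by
          change max (val (x i)) v ∈ S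
          rw [max_eq_left (hG i hi).1.le]
          exact (hG i hi).2
        rw [Set.indicator_of_mem hmem]
        exact hamp i hi k
    _ = ∑ b ∈ (G ×ˢ Finset.univ).map ⟨_, hinj⟩,
          ((fun b : Label d l (Fin n × Bool) => max (val b.2.1) v) ⁻¹' S).indicator
            (fun b => ‖((raise d val n).at v).state x (2 * n + 1) b‖ ^ 2) b := by
        rw [Finset.sum_map, Finset.sum_product]
        rfl
    _ ≤ ((raise d val n).at v).prob x S :=
        Finset.sum_le_sum_of_subset_of_nonneg (Finset.subset_univ _) fun b _ _ =>
          Set.indicator_nonneg (fun _ _ => by positivity) _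

end Raise

/-! ### Maximum finding -/

/-- The thresholds of rank less than `t` that the search for the maximum of `F` can reach: the values
of `F` and the initial threshold `-1`, which every nonnegative value exceeds. -/
def top (F : Fin d → ℝ) (t : ℕ) : Set ℝ := {v | (v = -1 ∨ ∃ i, v = F i) ∧ rank F v < t}

theorem max_mem_top {F : Fin d → ℝ} {t : ℕ} {v : ℝ} (h : v ∈ top F t) (i : Fin d) :
    max (F i) v ∈ top F t := by
  refine ⟨?_, (rank_anti F (le_max_right _ _)).trans_lt h.2⟩
  rcases max_choice (F i) v with h' | h'
  · exact Or.inr ⟨i, h'⟩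
  · rw [h']
    exact h.1

/-- One step of maximum finding divides the rank by four with constant probability. -/
theorem le_prob_raise_top [NeZero d] (val : BitString l → ℝ) (n : ℕ) [NeZero n]
    (x : Fin d → BitString l) {t : ℕ} (ht0 : 0 < t) (htd : t ≤ d) (hn : d ≤ n ^ 2 * t) {v : ℝ}
    (hv : v ∈ top (fun i => val (x i)) (4 * t)) :
    1 / 32 ≤ ((raise d val n).at v).prob x (top (fun i => val (x i)) t) := by
  by_cases hvt : v ∈ top (fun i => val (x i)) t
  · rw [prob_raise_eq_one val n v x fun i => max_mem_top hvt i]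
    norm_num
  have htr : t ≤ rank (fun i => val (x i)) v := by
    by_contra! h
    exact hvt ⟨hv.1, h⟩
  have hG := le_prob_raise val n v x (S := top (fun i => val (x i)) t)
    (Finset.univ.filter fun i => rank (fun i => val (x i)) (val (x i)) < t) (fun i hi => by
      have hi' := (Finset.mem_filter.1 hi).2
      refine ⟨?_, Or.inr ⟨i, rfl⟩, hi'⟩
      by_contra! h
      exact absurd (rank_anti (fun i => val (x i)) h) (by omega)) (by omega)
      (hn.trans (Nat.mul_le_mul_left _ htr))
  refine le_trans ?_ hG
  have hc : (t : ℝ) ≤ ((Finset.univ.filter fun i =>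
      rank (fun i => val (x i)) (val (x i)) < t).card : ℝ) := by
    exact_mod_cast le_card_rank_lt (fun i => val (x i)) htd
  have hr : (rank (fun i => val (x i)) v : ℝ) ≤ 4 * t := by
    exact_mod_cast hv.2.le
  have hr0 : (0 : ℝ) < rank (fun i => val (x i)) v := by
    exact_mod_cast ht0.trans_le htr
  rw [div_le_div_iff₀ (by norm_num) (by positivity)]
  nlinarith

/-- Repeating a step of maximum finding makes the probability that the rank is not divided by four
exponentially small. -/
theorem exists_repeat_raise [NeZero d] (val : BitString l → ℝ) (n : ℕ) [NeZero n] {t : ℕ}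
    (ht0 : 0 < t) (htd : t ≤ d) (hn : d ≤ n ^ 2 * t) (A : QueryAlgorithm d l) {p : ℝ}
    {X : Set (Fin d → BitString l)}
    (hA : ∀ x ∈ X, p ≤ A.prob x (top (fun i => val (x i)) (4 * t))) (j : ℕ) :
    ∃ B : QueryAlgorithm d l, B.queries = A.queries + j * (2 * n + 1) ∧
      ∀ x ∈ X, p ≤ B.prob x (top (fun i => val (x i)) (4 * t)) ∧
        p - (31 / 32) ^ j ≤ B.prob x (top (fun i => val (x i)) t) := by
  induction j with
  | zero =>
    refine ⟨A, by simp, fun x hx => ⟨hA x hx, ?_⟩⟩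
    have h1 := A.prob_compl x (top (fun i => val (x i)) (4 * t))
    have h2 := A.prob_nonneg x (top (fun i => val (x i)) (4 * t))ᶜ
    have h3 := A.prob_nonneg x (top (fun i => val (x i)) t)
    have h4 := hA x hx
    rw [pow_zero]
    linarith
  | succ j ih =>
    obtain ⟨B, hBq, hB⟩ := ih
    refine ⟨B.bind (raise d val n), ?_, fun x hx => ?_⟩
    · change B.queries + (2 * n + 1) = _
      rw [hBq]
      ring
    obtain ⟨h1, h2⟩ := hB x hx
    constructor
    · have := B.mul_le_prob_bind (raise d val n) x zero_le_one h1 fun v hv =>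
        (prob_raise_eq_one val n v x fun i => max_mem_top hv i).ge
      rwa [mul_one] at this
    · have h3 := B.prob_bind_subset (raise d val n) x
        (S := top (fun i => val (x i)) (4 * t)) (T := top (fun i => val (x i)) t) (q := 1 / 32)
        (fun v hv => ⟨hv.1, by have := hv.2; omega⟩)
        (fun v hv => prob_raise_eq_one val n v x fun i => max_mem_top hv i)
        (fun v hv => le_prob_raise_top val n x ht0 htd hn hv)
      rw [pow_succ]
      linarith

/-- Maximum finding from a value of rank less than `4 ^ s`. The rank is divided by four in `s`
phases; the failure probabilities `2⁻⁽ˢ⁺⁴⁾` and the costs `110 (s + 4) √d / 2 ^ s` of the phases are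
summable. -/
theorem exists_maximum_of_top [NeZero d] (val : BitString l → ℝ) (X : Set (Fin d → BitString l))
    (s : ℕ) (hs : 4 ^ s ≤ 4 * d) (A : QueryAlgorithm d l) {p : ℝ}
    (hA : ∀ x ∈ X, p ≤ A.prob x (top (fun i => val (x i)) (4 ^ s))) :
    ∃ B : QueryAlgorithm d l,
      (B.queries : ℝ) ≤ A.queries + 110 * √(d : ℝ) * (10 - (2 * s + 10) / 2 ^ s) ∧
      ∀ x ∈ X, p - (1 / 8 - 1 / 8 / 2 ^ s) ≤ B.prob x (top (fun i => val (x i)) 1) := by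
  induction s generalizing A p with
  | zero => exact ⟨A, by norm_num, fun x hx => by simpa using hA x hx⟩
  | succ s ih =>
    have hsd : 4 ^ s ≤ d := by
      rw [pow_succ] at hs
      omega
    have hd0 : (0 : ℝ) < d := Nat.cast_pos.2 (NeZero.pos d)
    have h2 : (2 : ℝ) ^ s ≤ √(d : ℝ) := by
      refine Real.le_sqrt_of_sq_le ?_
      rw [← pow_mul, mul_comm, pow_mul]
      norm_num
      exact_mod_cast hsd
    have hy : 1 ≤ √(d : ℝ) / 2 ^ s := (one_le_div (by positivity)).2 h2
    set n := ⌈√(d : ℝ) / 2 ^ s⌉₊ with hn_def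
    have hn0 : NeZero n := ⟨(Nat.ceil_pos.2 (by linarith)).ne'⟩
    have hn1 : √(d : ℝ) / 2 ^ s ≤ n := Nat.le_ceil _
    have hn2 : (n : ℝ) < √(d : ℝ) / 2 ^ s + 1 := Nat.ceil_lt_add_one (by linarith)
    have hn : d ≤ n ^ 2 * 4 ^ s := by
      have h3 : √(d : ℝ) ≤ n * 2 ^ s := (div_le_iff₀ (by positivity)).1 hn1
      have h4 : (d : ℝ) ≤ (n * 2 ^ s) ^ 2 := by
        rw [← Real.sq_sqrt hd0.le]
        gcongr
      rw [mul_pow, ← pow_mul, mul_comm s, pow_mul] at h4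
      norm_num at h4
      exact_mod_cast h4
    obtain ⟨B, hBq, hB⟩ := exists_repeat_raise val n (t := 4 ^ s) (by positivity) hsd hn A
      (p := p) (X := X) (fun x hx => by rw [← pow_succ']; exact hA x hx) (22 * (s + 4))
    obtain ⟨B', hBq', hB'⟩ := ih (by omega) B fun x hx => (hB x hx).2
    refine ⟨B', ?_, fun x hx => ?_⟩
    · have h5 : (B.queries : ℝ) ≤ A.queries + 22 * (s + 4) * (5 * (√(d : ℝ) / 2 ^ s)) := by
        rw [hBq]
        push_cast
        gcongr
        linarith
      refine hBq'.trans ?_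
      have h6 : 110 * √(d : ℝ) * (10 - (2 * (s + 1 : ℕ) + 10) / 2 ^ (s + 1)) =
          22 * (s + 4) * (5 * (√(d : ℝ) / 2 ^ s)) +
            110 * √(d : ℝ) * (10 - (2 * s + 10) / 2 ^ s) := by
        push_cast
        field_simp
        ring
      linarith
    · refine le_trans ?_ (hB' x hx)
      -- `(31 / 32) ^ 22 ≤ 1 / 2`
      have h7 : ((31 : ℝ) / 32) ^ (22 * (s + 4)) ≤ (1 / 2) ^ (s + 4) := by
        rw [pow_mul]
        gcongr
        norm_num
      have h8 : ((1 : ℝ) / 2) ^ (s + 4) = 1 / 8 / 2 ^ s - 1 / 8 / 2 ^ (s + 1) := by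
        rw [_root_.one_div_pow]
        field_simp
        ring
      linarith

/-- The algorithm that returns `c` without any query. -/
def constant (d l : ℕ) [NeZero d] (c : ℝ) : QueryAlgorithm d l where
  W := Unit
  start := (0, (fun _ => false), ())
  queries := 0
  gate _ := 1
  output _ := c

/-- Maximum finding: with `O(√d)` queries, an algorithm returns the maximum of any nonnegative table
with probability at least `7 / 8`. -/
theorem exists_maximum [NeZero d] (val : BitString l → ℝ) :
    ∃ A : QueryAlgorithm d l, (A.queries : ℝ) ≤ 1100 * √(d : ℝ) ∧
      ∀ x : Fin d → BitString l, (∀ i, 0 ≤ val (x i)) →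
        7 / 8 ≤ A.prob x {v | (∃ i, v = val (x i)) ∧ ∀ i, val (x i) ≤ v} := by
  obtain ⟨B, hBq, hB⟩ := exists_maximum_of_top val Set.univ (Nat.log 4 d + 1)
    (by rw [pow_succ']; exact Nat.mul_le_mul_left _ (Nat.pow_log_le_self 4 (NeZero.ne d)))
    (constant d l (-1)) (p := 1) fun x _ => by
      refine ((constant d l (-1)).prob_eq_one x fun b _ => ?_).ge
      refine ⟨Or.inl rfl, ?_⟩
      refine lt_of_le_of_lt ?_ (Nat.lt_pow_succ_log_self (by norm_num) d)
      exact (Finset.card_le_univ _).trans_eq (Fintype.card_fin d)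
  refine ⟨B, ?_, fun x hx => ?_⟩
  · refine hBq.trans ?_
    change ((0 : ℕ) : ℝ) + _ ≤ _
    rw [Nat.cast_zero, zero_add, show (1100 : ℝ) * √(d : ℝ) = 110 * √(d : ℝ) * 10 by ring]
    gcongr
    refine sub_le_self _ ?_
    positivity
  · have h1 := hB x (Set.mem_univ x)
    have h2 : (0 : ℝ) ≤ 1 / 8 / 2 ^ (Nat.log 4 d + 1) := by positivity
    have h3 : 7 / 8 ≤ B.prob x (top (fun i => val (x i)) 1) := by linarith
    refine h3.trans (B.prob_mono x fun v hv => ?_)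
    have hle : ∀ i, val (x i) ≤ v := by
      intro i
      by_contra! h
      have h3 : 0 < rank (fun i => val (x i)) v :=
        Finset.card_pos.2 ⟨i, Finset.mem_filter.2 ⟨Finset.mem_univ _, h⟩⟩
      have := hv.2
      omega
    refine ⟨hv.1.resolve_left fun h => ?_, hle⟩
    have := (hx 0).trans (hle 0)
    rw [h] at this
    norm_num at this

/-! ### Measurement in the eigenbasis of a path -/

/-- Half the adjacency matrix of a path with `N` vertices. -/
def pathMatrix (N : ℕ) : Matrix (Fin N) (Fin N) ℂ :=
  Matrix.of fun j k => (if (k : ℕ) = j + 1 then 1 / 2 else 0) + if (j : ℕ) = k + 1 then 1 / 2 else 0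

theorem pathMatrix_isHermitian (N : ℕ) : (pathMatrix N).IsHermitian := by
  ext j k
  simp only [conjTranspose_apply, pathMatrix, Matrix.of_apply, star_add, apply_ite star, star_zero]
  rw [add_comm]
  simp

theorem pathMatrix_mulVec {N : ℕ} (f : ℕ → ℂ) (h0 : f 0 = 0) (hN : f (N + 1) = 0) (k : Fin N) :
    (pathMatrix N *ᵥ fun j => f (j + 1)) k = 1 / 2 * (f (k + 2) + f k) := by
  simp only [mulVec, dotProduct, pathMatrix, Matrix.of_apply, add_mul, ite_mul, zero_mul,
    Finset.sum_add_distrib]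
  rw [mul_add]
  congr 1
  · rw [Fin.sum_univ_eq_sum_range fun j => if j = (k : ℕ) + 1 then 1 / 2 * f (j + 1) else 0,
      Finset.sum_ite_eq']
    split_ifs with h
    · rfl
    · have hk : (k : ℕ) + 2 = N + 1 := by
        rw [Finset.mem_range] at h
        omega
      rw [hk, hN, mul_zero]
  · rw [Fin.sum_univ_eq_sum_range fun j => if (k : ℕ) = j + 1 then 1 / 2 * f (j + 1) else 0]
    rcases Nat.eq_zero_or_pos (k : ℕ) with hk | hk
    · rw [hk, h0, mul_zero]
      exact Finset.sum_eq_zero fun j _ => if_neg (by omega)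
    · rw [Finset.sum_eq_single ((k : ℕ) - 1)]
      · rw [if_pos (by omega), Nat.sub_add_cancel hk]
      · intro j _ hj
        exact if_neg (by omega)
      · intro h
        exact absurd (Finset.mem_range.2 (by omega)) h

/-- The mean squared deviation from `c` of the eigenvalue that is measured in the eigenbasis of a
Hermitian matrix `H` is the squared norm of `(H - c) φ`. -/
theorem sum_sq_eigenvalues_sub {n : Type*} [Fintype n] [DecidableEq n] {H : Matrix n n ℂ}
    (hH : H.IsHermitian) (φ : n → ℂ) (c : ℝ) :
    ∑ k, ‖((hH.eigenvectorUnitary⁻¹).1 *ᵥ φ) k‖ ^ 2 * (hH.eigenvalues k - c) ^ 2 =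
      ∑ k, ‖(H *ᵥ φ) k - c * φ k‖ ^ 2 := by
  have h1 : (hH.eigenvectorUnitary⁻¹).1 * H =
      diagonal (fun k => (hH.eigenvalues k : ℂ)) * (hH.eigenvectorUnitary⁻¹).1 := by
    refine (congrArg (fun A => (hH.eigenvectorUnitary⁻¹).1 * A) hH.spectral_theorem).trans ?_
    rw [Unitary.conjStarAlgAut_apply, UnitaryGroup.inv_val, ← mul_assoc, ← mul_assoc,
      UnitaryGroup.star_mul_self, one_mul]
    rfl
  have h2 : (hH.eigenvectorUnitary⁻¹).1 *ᵥ (H *ᵥ φ - (c : ℂ) • φ) =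
      fun k => ((hH.eigenvalues k - c : ℝ) : ℂ) * ((hH.eigenvectorUnitary⁻¹).1 *ᵥ φ) k := by
    rw [mulVec_sub, mulVec_smul, mulVec_mulVec, h1, ← mulVec_mulVec]
    funext k
    rw [Pi.sub_apply, mulVec_diagonal, Pi.smul_apply, smul_eq_mul]
    push_cast
    ring
  refine Eq.trans ?_ (sum_norm_sq_mulVec hH.eigenvectorUnitary⁻¹ (H *ᵥ φ - (c : ℂ) • φ))
  rw [h2]
  refine Finset.sum_congr rfl fun k _ => ?_
  rw [norm_mul, mul_pow, Complex.norm_real, Real.norm_eq_abs, sq_abs, mul_comm]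

/-- The window that weights the counter. It vanishes at both ends, and its second difference is
constant. -/
def window (M k : ℕ) : ℝ := k * ((M : ℝ) - k)

theorem sum_window_sq (N : ℕ) :
    ∑ k : Fin N, window (N + 1) (k + 1) ^ 2 = ((N + 1 : ℝ) ^ 5 - (N + 1)) / 30 := by
  have key : ∀ (M : ℝ) (m : ℕ), ∑ k ∈ Finset.range m, (((k : ℝ) + 1) * (M - (k + 1))) ^ 2 =
      M ^ 2 * (m * (m + 1) * (2 * m + 1)) / 6 - M * (m ^ 2 * (m + 1) ^ 2) / 2 +
        m * (m + 1) * (2 * m + 1) * (3 * m ^ 2 + 3 * m - 1) / 30 := by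
    intro M m
    induction m with
    | zero => simp
    | succ m ih =>
      rw [Finset.sum_range_succ, ih]
      push_cast
      ring
  rw [Fin.sum_univ_eq_sum_range fun k => window (N + 1) (k + 1) ^ 2]
  have h := key (N + 1) N
  simp only [window]
  push_cast
  rw [h]
  ring

theorem le_sum_window_sq (N : ℕ) [NeZero N] :
    ((N : ℝ) + 1) ^ 5 / 32 ≤ ∑ k : Fin N, window (N + 1) (k + 1) ^ 2 := by
  rw [sum_window_sq]
  have hN : (1 : ℝ) ≤ N := by exact_mod_cast NeZero.pos N
  have h4 : (2 : ℝ) ^ 4 ≤ ((N : ℝ) + 1) ^ 4 := by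
    gcongr
    linarith
  have h5 := mul_le_mul_of_nonneg_left h4 (by linarith : (0 : ℝ) ≤ N + 1)
  rw [← pow_succ'] at h5
  norm_num at h5
  linarith

/-- For a rotating sequence of unit vectors, the windowed sequence is nearly an eigenvector of the
path: its first difference, of order `M`, meets the first difference of the rotation, of order
`√(1 - c ^ 2)`, and its second difference is bounded. -/
theorem sum_norm_sq_window_sub_le {B : Type*} [Fintype B] (u : ℕ → B → ℂ) (c : ℝ)
    (hu : ∀ m, ∑ b, ‖u m b‖ ^ 2 = 1)
    (hrec : ∀ m b, u (m + 2) b + u m b = 2 * c * u (m + 1) b) {N k : ℕ} (hk : k < N) :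
    ∑ b, ‖1 / 2 * (window (N + 1) (k + 2) * u (k + 2) b + window (N + 1) k * u k b) -
      c * (window (N + 1) (k + 1) * u (k + 1) b)‖ ^ 2 ≤ 2 * (N + 1) ^ 2 * (1 - c ^ 2) + 2 := by
  have hpar : ∑ b, ‖u (k + 2) b - u k b‖ ^ 2 = 4 * (1 - c ^ 2) := by
    have h1 : ∑ b, (‖u (k + 2) b + u k b‖ ^ 2 + ‖u (k + 2) b - u k b‖ ^ 2) =
        ∑ b, (2 * ‖u (k + 2) b‖ ^ 2 + 2 * ‖u k b‖ ^ 2) :=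
      Finset.sum_congr rfl fun b _ => by
        have := parallelogram_law_with_norm ℝ (u (k + 2) b) (u k b)
        rw [this]
        ring
    have h2 : ∀ b, ‖u (k + 2) b + u k b‖ ^ 2 = 4 * c ^ 2 * ‖u (k + 1) b‖ ^ 2 := by
      intro b
      rw [hrec, norm_mul, norm_mul, Complex.norm_real, Real.norm_eq_abs, mul_pow, mul_pow, sq_abs]
      norm_num
    simp only [Finset.sum_add_distrib, ← Finset.mul_sum, hu, h2] at h1
    linarith
  have hc : 0 ≤ 1 - c ^ 2 := by
    have : 0 ≤ ∑ b, ‖u (k + 2) b - u k b‖ ^ 2 := Finset.sum_nonneg fun _ _ => by positivity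
    linarith
  have hterm : ∀ b, ‖1 / 2 * (window (N + 1) (k + 2) * u (k + 2) b + window (N + 1) k * u k b) -
      c * (window (N + 1) (k + 1) * u (k + 1) b)‖ ^ 2 ≤
      (N + 1) ^ 2 / 2 * ‖u (k + 2) b - u k b‖ ^ 2 + 2 * c ^ 2 * ‖u (k + 1) b‖ ^ 2 := by
    intro b
    have h1 : 1 / 2 * (window (N + 1) (k + 2) * u (k + 2) b + window (N + 1) k * u k b) -
        c * (window (N + 1) (k + 1) * u (k + 1) b) =
        ((((N : ℝ) - 2 * k - 1) / 2 : ℝ) : ℂ) * (u (k + 2) b - u k b) - (c : ℂ) * u (k + 1) b := by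
      simp only [window]
      push_cast
      linear_combination (((N + 1 : ℂ) * (k + 1) - (k + 1) ^ 2) / 2 - 1 / 2) * hrec k b
    have h2 : |((N : ℝ) - 2 * k - 1) / 2| ≤ (N + 1) / 2 := by
      have : (k : ℝ) < N := by exact_mod_cast hk
      have : (0 : ℝ) ≤ k := Nat.cast_nonneg k
      rw [abs_le]
      constructor <;> linarith
    rw [h1]
    calc _ ≤ (‖((((N : ℝ) - 2 * k - 1) / 2 : ℝ) : ℂ) * (u (k + 2) b - u k b)‖ +
          ‖(c : ℂ) * u (k + 1) b‖) ^ 2 := by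
          gcongr
          exact norm_sub_le _ _
      _ ≤ 2 * (‖((((N : ℝ) - 2 * k - 1) / 2 : ℝ) : ℂ) * (u (k + 2) b - u k b)‖ ^ 2 +
          ‖(c : ℂ) * u (k + 1) b‖ ^ 2) := add_sq_le
      _ = 2 * (|((N : ℝ) - 2 * k - 1) / 2| ^ 2 * ‖u (k + 2) b - u k b‖ ^ 2 +
          c ^ 2 * ‖u (k + 1) b‖ ^ 2) := by
          rw [norm_mul, norm_mul, mul_pow, mul_pow, Complex.norm_real, Complex.norm_real,
            Real.norm_eq_abs, Real.norm_eq_abs, sq_abs c]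
      _ ≤ 2 * (((N + 1) / 2) ^ 2 * ‖u (k + 2) b - u k b‖ ^ 2 + c ^ 2 * ‖u (k + 1) b‖ ^ 2) := by
          gcongr
      _ = _ := by ring
  refine (Finset.sum_le_sum fun b _ => hterm b).trans ?_
  rw [Finset.sum_add_distrib, ← Finset.mul_sum, ← Finset.mul_sum, hpar, hu]
  nlinarith

/-! ### Mean estimation -/

/-- Chebyshev's inequality: if every output outside of `S` has squared deviation at least `Δ`, then
the mean squared deviation bounds the probability to miss `S`. -/
theorem QueryAlgorithm.prob_ge_of_sum_le (A : QueryAlgorithm d l) (x : Fin d → BitString l)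
    {S : Set ℝ} (dev : Label d l A.W → ℝ) (hdev : ∀ b, 0 ≤ dev b) {Δ q : ℝ} (hΔ : 0 < Δ)
    (hS : ∀ b, A.output b ∉ S → Δ ≤ dev b)
    (hsum : ∑ b, ‖A.state x A.queries b‖ ^ 2 * dev b ≤ q * Δ) : 1 - q ≤ A.prob x S := by
  have h : A.prob x Sᶜ * Δ ≤ q * Δ := by
    refine le_trans ?_ hsum
    rw [prob, Finset.sum_mul]
    refine Finset.sum_le_sum fun b _ => ?_
    by_cases hb : A.output b ∈ S
    · rw [Set.indicator_of_notMem (s := A.output ⁻¹' Sᶜ) (fun h => h hb), zero_mul]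
      exact mul_nonneg (by positivity) (hdev b)
    · rw [Set.indicator_of_mem (s := A.output ⁻¹' Sᶜ) hb]
      exact mul_le_mul_of_nonneg_left (hS b hb) (by positivity)
  have h1 := le_of_mul_le_mul_right h hΔ
  rw [A.prob_compl] at h1
  linarith

/-- The normalized window. -/
def windowWeight (N : ℕ) (k : Fin N) : ℝ :=
  window (N + 1) (k + 1) / √(∑ j : Fin N, window (N + 1) (j + 1) ^ 2)

theorem sum_windowWeight_sq (N : ℕ) [NeZero N] : ∑ k : Fin N, windowWeight N k ^ 2 = 1 := by
  have h0 : 0 < ∑ j : Fin N, window (N + 1) (j + 1) ^ 2 :=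
    lt_of_lt_of_le (by positivity) (le_sum_window_sq N)
  simp only [windowWeight, div_pow, Real.sq_sqrt h0.le, ← Finset.sum_div]
  exact div_self h0.ne'

/-- The angle that encodes the value relative to the scale `v`. -/
def valueAngle (val : BitString l → ℝ) (v : ℝ) (z : BitString l) : ℝ := Real.arccos (1 - val z / v)

/-- The counter, measured in the eigenbasis of the path. -/
def pathGate (d l N : ℕ) : unitaryGroup (Label d l (Fin N × Bool)) ℂ :=
  ctrl ((splitCounter d l N).trans (Equiv.prodComm _ _)) fun _ =>
    (pathMatrix_isHermitian N).eigenvectorUnitary⁻¹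

/-- Estimation of the mean of values between `0` and the parameter `v`: the walk rotates by an angle
of cosine `1 - mean / v`, which is estimated by an eigenvalue of the path. -/
def estimate (d : ℕ) [NeZero d] (val : BitString l → ℝ) (N : ℕ) [NeZero N] : Routine d l :=
  walkRoutine (sum_windowWeight_sq N) (valueAngle val) (pathGate d l N) fun v b =>
    v * (1 - (pathMatrix_isHermitian N).eigenvalues b.2.2.1)

section Estimate

variable [NeZero d] (val : BitString l → ℝ) (N : ℕ) [NeZero N] (v : ℝ) (x : Fin d → BitString l)

/-- The mean squared error of the estimate of the cosine. -/
theorem sum_sq_estimate_le {c : ℝ} (hc : c = mean fun i => Real.cos (valueAngle val v (x i))) :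
    ∑ b : Label d l (Fin N × Bool), ‖((estimate d val N).at v).state x (2 * N + 1) b‖ ^ 2 *
      ((pathMatrix_isHermitian N).eigenvalues b.2.2.1 - c) ^ 2 ≤
        64 * ((1 - c ^ 2) / (N + 1) ^ 2 + 1 / (N + 1) ^ 4) := by
  set Z := ∑ j : Fin N, window (N + 1) (j + 1) ^ 2 with hZ
  have hZ1 : ((N : ℝ) + 1) ^ 5 / 32 ≤ Z := le_sum_window_sq N
  have hZ0 : 0 < Z := lt_of_lt_of_le (by positivity) hZ1
  set u : ℕ → Label d l Bool → ℂ := fun m b => walk (valueAngle val v) x m (queryLabel x b) with hu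
  have hu1 : ∀ m, ∑ b, ‖u m b‖ ^ 2 = 1 := fun m =>
    ((queryLabel_involutive x).bijective.sum_comp fun b =>
      ‖walk (valueAngle val v) x m b‖ ^ 2).trans (sum_norm_sq_walk _ _ m)
  have hrec : ∀ m b, u (m + 2) b + u m b = 2 * c * u (m + 1) b := fun m b => by
    rw [hc]
    exact congrFun (walk_add_two (valueAngle val v) x m) (queryLabel x b)
  have hstate : ((estimate d val N).at v).state x (2 * N + 1) = (pathGate d l N).1 *ᵥ
      fun b => (windowWeight N b.2.2.1 : ℂ) * u (b.2.2.1 + 1) (b.1, b.2.1, b.2.2.2) :=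
    state_walkRoutine (sum_windowWeight_sq N) (valueAngle val) (pathGate d l N) _ v x
  set e := (splitCounter d l N).trans (Equiv.prodComm _ _) with he
  have hcol : ∀ b : Label d l Bool, ∑ k : Fin N,
      ‖((estimate d val N).at v).state x (2 * N + 1) (e.symm (k, b))‖ ^ 2 *
        ((pathMatrix_isHermitian N).eigenvalues k - c) ^ 2 =
      ∑ k : Fin N, ‖1 / 2 * (window (N + 1) (k + 2) * u (k + 2) b + window (N + 1) k * u k b) -
        c * (window (N + 1) (k + 1) * u (k + 1) b)‖ ^ 2 / Z := by
    intro b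
    have h1 : ∀ k : Fin N, ((estimate d val N).at v).state x (2 * N + 1) (e.symm (k, b)) =
        ((pathMatrix_isHermitian N).eigenvectorUnitary⁻¹.1 *ᵥ
          fun k => (windowWeight N k : ℂ) * u (k + 1) b) k := by
      intro k
      rw [hstate]
      exact ctrl_mulVec e _ _ k b
    simp only [h1]
    rw [sum_sq_eigenvalues_sub]
    refine Finset.sum_congr rfl fun k _ => ?_
    have h2 : (fun k : Fin N => (windowWeight N k : ℂ) * u (k + 1) b) =
        ((1 / √Z : ℝ) : ℂ) • fun k : Fin N =>
          (fun m => (window (N + 1) m : ℂ) * u m b) ((k : ℕ) + 1) := by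
      funext k
      simp only [windowWeight, Pi.smul_apply, smul_eq_mul]
      push_cast
      ring
    have h3 : (windowWeight N k : ℂ) * u (k + 1) b =
        ((1 / √Z : ℝ) : ℂ) * (window (N + 1) (k + 1) * u (k + 1) b) := congrFun h2 k
    rw [h2, h3, mulVec_smul, Pi.smul_apply,
      pathMatrix_mulVec (fun m => (window (N + 1) m : ℂ) * u m b) (by simp [window])
        (by simp [window]), smul_eq_mul, mul_left_comm (c : ℂ), ← mul_sub, norm_mul, mul_pow,
      Complex.norm_real, Real.norm_eq_abs, sq_abs, div_pow, one_pow, Real.sq_sqrt hZ0.le,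
      one_div_mul_eq_div]
  have hM0 : (0 : ℝ) < N + 1 := by positivity
  calc _ = ∑ b, ∑ k : Fin N, ‖((estimate d val N).at v).state x (2 * N + 1) (e.symm (k, b))‖ ^ 2 *
        ((pathMatrix_isHermitian N).eigenvalues k - c) ^ 2 := by
        rw [← Finset.sum_comm, ← Fintype.sum_prod_type']
        exact (e.symm.sum_comp _).symm
    _ = ∑ k : Fin N, (∑ b, ‖1 / 2 * (window (N + 1) (k + 2) * u (k + 2) b +
          window (N + 1) k * u k b) - c * (window (N + 1) (k + 1) * u (k + 1) b)‖ ^ 2) / Z := by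
        simp only [hcol, Finset.sum_div]
        exact Finset.sum_comm
    _ ≤ ∑ _k : Fin N, (2 * (N + 1) ^ 2 * (1 - c ^ 2) + 2) / Z := by
        refine Finset.sum_le_sum fun k _ => ?_
        have := sum_norm_sq_window_sub_le u c hu1 hrec k.2
        gcongr
    _ = N * (2 * (N + 1) ^ 2 * (1 - c ^ 2) + 2) / Z := by
        rw [Finset.sum_const, Finset.card_univ, Fintype.card_fin, nsmul_eq_mul]
        ring
    _ ≤ (N + 1) * (2 * (N + 1) ^ 2 * (1 - c ^ 2) + 2) / ((N + 1) ^ 5 / 32) := by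
        have h3 : 0 ≤ 2 * (N + 1) ^ 2 * (1 - c ^ 2) + 2 :=
          le_trans (Finset.sum_nonneg fun _ _ => by positivity)
            (sum_norm_sq_window_sub_le u c hu1 hrec (NeZero.pos N))
        gcongr
        linarith
    _ = _ := by
        field_simp
        ring

/-- At the scale of the maximum, `N ≥ 40 √d / δ` walk steps give the mean with relative error `δ`. -/
theorem le_prob_estimate {δ : ℝ} (hδ0 : 0 < δ) (hδ1 : δ < 1) (hN : 40 * √(d : ℝ) / δ ≤ N)
    (hx : ∀ i, 0 ≤ val (x i)) (hv : ∃ i, v = val (x i)) (hmax : ∀ i, val (x i) ≤ v) :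
    7 / 8 ≤ ((estimate d val N).at v).prob x
      {y | |y - mean fun i => val (x i)| ≤ δ * mean fun i => val (x i)} := by
  have hd0 : (0 : ℝ) < d := Nat.cast_pos.2 (NeZero.pos d)
  obtain ⟨i₀, hi₀⟩ := hv
  have hv0 : 0 ≤ v := hi₀ ▸ hx i₀
  rcases hv0.eq_or_lt with hv0 | hv0
  · -- All values vanish, and so does every output.
    have h0 : ∀ i, val (x i) = 0 := fun i => le_antisymm (hv0 ▸ hmax i) (hx i)
    rw [QueryAlgorithm.prob_eq_one]
    · norm_num
    · intro b _
      change |v * _ - mean fun i => val (x i)| ≤ δ * mean fun i => val (x i)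
      simp [mean, h0, ← hv0]
  set m : ℝ := mean fun i => val (x i) with hm
  set a : ℝ := m / v with ha
  have hmv : m = v * a := by
    rw [ha]
    field_simp
  have ha1 : 1 / d ≤ a := by
    rw [ha, le_div_iff₀ hv0, hm, mean]
    gcongr
    rw [hi₀]
    exact Finset.single_le_sum (fun i _ => hx i) (Finset.mem_univ i₀)
  have ha0 : 0 < a := lt_of_lt_of_le (by positivity) ha1
  have hc : 1 - a = mean fun i => Real.cos (valueAngle val v (x i)) := by
    have h1 : ∀ i, Real.cos (valueAngle val v (x i)) = 1 - val (x i) / v := by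
      intro i
      have h2 : 0 ≤ val (x i) / v := div_nonneg (hx i) hv0.le
      have h3 : val (x i) / v ≤ 1 := (div_le_one hv0).2 (hmax i)
      exact Real.cos_arccos (by linarith) (by linarith)
    rw [ha, hm, mean, mean]
    simp only [h1, Finset.sum_sub_distrib, ← Finset.sum_div]
    simp
    field_simp
  have hdev := sum_sq_estimate_le val N v x hc
  have hM : 1600 * d / δ ^ 2 ≤ ((N : ℝ) + 1) ^ 2 := by
    have h1 : 40 * √(d : ℝ) / δ ≤ N + 1 := by linarith
    calc 1600 * d / δ ^ 2 = (40 * √(d : ℝ) / δ) ^ 2 := by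
          rw [div_pow, mul_pow, Real.sq_sqrt hd0.le]
          norm_num
      _ ≤ _ := by gcongr
  -- With `d ≥ 1 / a`, the inverse square of the number of steps is at most `δ ^ 2 * a / 1600`.
  have hM' : 1 / ((N : ℝ) + 1) ^ 2 ≤ δ ^ 2 * a / 1600 := by
    have h1 : 1 ≤ a * d := by rwa [div_le_iff₀ hd0] at ha1
    have h2 : 1600 / (δ ^ 2 * a) ≤ ((N : ℝ) + 1) ^ 2 := by
      refine le_trans ?_ hM
      rw [div_le_div_iff₀ (by positivity) (by positivity)]
      have h3 := mul_le_mul_of_nonneg_left h1 (by positivity : 0 ≤ 1600 * δ ^ 2)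
      linarith
    calc 1 / ((N : ℝ) + 1) ^ 2 ≤ 1 / (1600 / (δ ^ 2 * a)) := by gcongr
      _ = _ := one_div_div _ _
  have hbound : 64 * ((1 - (1 - a) ^ 2) / ((N : ℝ) + 1) ^ 2 + 1 / ((N : ℝ) + 1) ^ 4) ≤
      1 / 8 * (δ * a) ^ 2 := by
    set y : ℝ := 1 / ((N : ℝ) + 1) ^ 2 with hy
    have hy0 : 0 ≤ y := by positivity
    have h1 : (1 - (1 - a) ^ 2) / ((N : ℝ) + 1) ^ 2 + 1 / ((N : ℝ) + 1) ^ 4 =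
        a * (2 - a) * y + y ^ 2 := by
      rw [hy]
      field_simp
      ring
    have hδ2 : δ ^ 2 ≤ 1 := pow_le_one₀ hδ0.le hδ1.le
    have h2 : y ^ 2 ≤ (δ * a) ^ 2 / 1600 ^ 2 := by
      calc y ^ 2 ≤ (δ ^ 2 * a / 1600) ^ 2 := by gcongr
        _ = δ ^ 2 * ((δ * a) ^ 2 / 1600 ^ 2) := by ring
        _ ≤ 1 * ((δ * a) ^ 2 / 1600 ^ 2) := by gcongr
        _ = _ := one_mul _
    have h3 : a * (2 - a) * y ≤ 2 * (δ * a) ^ 2 / 1600 := by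
      calc a * (2 - a) * y ≤ a * 2 * (δ ^ 2 * a / 1600) := by
            gcongr
            linarith
        _ = _ := by ring
    rw [h1]
    nlinarith [sq_nonneg (δ * a)]
  have hcheb := ((estimate d val N).at v).prob_ge_of_sum_le x
    (S := {y | |y - m| ≤ δ * m}) (Δ := (δ * a) ^ 2) (q := 1 / 8)
    (fun b => ((pathMatrix_isHermitian N).eigenvalues b.2.2.1 - (1 - a)) ^ 2)
    (fun _ => sq_nonneg _) (by positivity) (fun b hb => ?_) (hdev.trans hbound)
  · linarith
  · have hb' : δ * m < |v * (1 - (pathMatrix_isHermitian N).eigenvalues b.2.2.1) - m| := not_le.1 hb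
    rw [hmv, ← mul_sub, abs_mul, abs_of_pos hv0, mul_left_comm, mul_lt_mul_iff_right₀ hv0] at hb'
    rw [← sq_abs (_ - (1 - a))]
    refine pow_le_pow_left₀ (by positivity) (hb'.le.trans_eq ?_) 2
    rw [← abs_neg]
    congr 1
    ring

end Estimate

end QuantumQuery

end

theorem lemma3p2 :
    ∃ C : ℝ, 0 < C ∧
      ∀ (d l : ℕ) (val : QuantumQuery.BitString l → ℝ) (δ : ℝ), 0 < d → 0 < δ →
        ∃ A : QuantumQuery.QueryAlgorithm d l,
          (A.queries : ℝ) ≤ C * (Real.sqrt (d : ℝ) / δ) ∧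
          ∀ (F : Fin d → ℝ) (x : Fin d → QuantumQuery.BitString l),
            (∀ i, F i ∈ Set.Icc (0 : ℝ) 1) → (∀ i, val (x i) = F i) →
              2 / 3 ≤ A.prob x
                {y : ℝ | |y - QuantumQuery.mean F| ≤ δ * QuantumQuery.mean F} := by
  refine ⟨1200, by norm_num, fun d l val δ hd hδ => ?_⟩
  have : NeZero d := ⟨hd.ne'⟩
  have hd1 : (1 : ℝ) ≤ d := by exact_mod_cast hd
  rcases le_or_gt 1 δ with hδ1 | hδ1
  · -- The estimate `0` has relative error one.
    refine ⟨QuantumQuery.constant d l 0, ?_, fun F x hF hx => ?_⟩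
    · change ((0 : ℕ) : ℝ) ≤ _
      rw [Nat.cast_zero]
      positivity
    · rw [QuantumQuery.QueryAlgorithm.prob_eq_one]
      · norm_num
      · intro b _
        change |0 - QuantumQuery.mean F| ≤ δ * QuantumQuery.mean F
        have h0 : 0 ≤ QuantumQuery.mean F :=
          mul_nonneg (by positivity) (Finset.sum_nonneg fun i _ => (hF i).1)
        rw [zero_sub, abs_neg, abs_of_nonneg h0]
        exact le_mul_of_one_le_left h0 hδ1
  · obtain ⟨A, hAq, hA⟩ := QuantumQuery.exists_maximum (d := d) val
    have hs1 : 1 ≤ √(d : ℝ) := Real.one_le_sqrt.2 hd1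
    have hy : √(d : ℝ) ≤ √(d : ℝ) / δ := le_div_self (by positivity) hδ hδ1.le
    set N := ⌈40 * √(d : ℝ) / δ⌉₊ with hN
    have hN0 : 0 < 40 * √(d : ℝ) / δ := by positivity
    have : NeZero N := ⟨(Nat.ceil_pos.2 hN0).ne'⟩
    have hN1 : (N : ℝ) < 40 * √(d : ℝ) / δ + 1 := Nat.ceil_lt_add_one hN0.le
    refine ⟨A.bind (QuantumQuery.estimate d val N), ?_, fun F x hF hx => ?_⟩
    · change ((A.queries + (2 * N + 1) : ℕ) : ℝ) ≤ _
      push_cast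
      rw [mul_div_assoc] at hN1
      linarith
    · obtain rfl : (fun i => val (x i)) = F := funext hx
      have hx0 : ∀ i, 0 ≤ val (x i) := fun i => (hF i).1
      have h := A.mul_le_prob_bind (QuantumQuery.estimate d val N) x (by norm_num) (hA x hx0)
        fun v hv => QuantumQuery.le_prob_estimate val N v x hδ hδ1 (Nat.le_ceil _) hx0 hv.1 hv.2
      exact le_trans (by norm_num) h
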